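/- Write points of $\mathbb R^3$ as $(x,y)$ with $x\in\mathbb R$, $y\in\mathbb R^2$, with dual variables $(\xi,\eta)\in\mathbb R\times\mathbb R^2$, and let $\phi(\xi,\eta)=\xi(\xi^2+|\eta|^2)$. For a tempered distribution $u_0$ on $\mathbb R^3$ let $U_\phi(t)u_0=\mathcal F^{-1}e^{it\phi}\mathcal F u_0$ $(t\in\mathbb R)$ be the solution of the linear Zakharov–Kuznetsov equation $$u_t+\partial_x\Delta u=0,\qquad u(0)=u_0 .$$ When, for almost every $t$, $U_\phi(t)u_0$ is given by a locally integrable function $u(t,\cdot)$ on $\mathbb R^3$, with $u$ measurable on $\mathbb R\times\mathbb R^3$, write $U_\phi u_0$ for the function $u$, which is unique up to null sets. Let $D_x^{-1/2}$ and $\langle D_x\rangle^s$ be the Fourier multipliers with symbols $|\xi|^{-1/2}$ and $\langle\xi\rangle^s=(1+\xi^2)^{s/2}$; here $D_x^{-1/2}u_0$ is understood for those $u_0$ whose Fourier transform is a locally integrable function. (i) Bilinear estimate. For every $s>\frac12$ there is a constant $C=C(s)$ such that for all tempered distributions $u_0,v_0$ on $\mathbb R^3$ with $D_x^{-1/2}u_0\in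 L^2(\mathbb R^3)$ and $\langle D_x\rangle^s v_0\in L^2(\mathbb R^3)$, the free solutions $U_\phi u_0$ and $U_\phi v_0$ are functions on space-time in the above sense, and $$\|U_\phi u_0\,U_\phi v_0\|_{L^2_{txy}(\mathbb R^4)}\le C\,\|D_x^{-1/2}u_0\|_{L^2_{xy}}\,\|\langle D_x\rangle^s v_0\|_{L^2_{xy}} .$$ (ii) $L^4$ Strichartz estimate. There is a constant $C$ such that for all $u_0\in L^2(\mathbb R^3)$ the free solution $U_\phi u_0$ is a function on space-time in the above sense, and $$\|U_\phi u_0\|_{L^4_{txy}(\mathbb R^4)}\le C\,\|u_0\|_{L^2_{xy}} .$$ -/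

import Mathlib

open MeasureTheory
open scoped SchwartzMap FourierTransform ENNReal NNReal

/-- The space `ℝ³ = ℝ × ℝ²`. The coordinate `0` is `x`, and the coordinates `1`, `2` are
`y = (y₁, y₂)`; on the Fourier side they are `ξ` and `η = (η₁, η₂)`. -/
abbrev Space3 : Type := EuclideanSpace ℝ (Fin 3)

/-- The phase function `φ(ξ, η) = ξ (ξ² + |η|²)`. -/
def zkPhase (ζ : Space3) : ℝ := ζ 0 * ((ζ 0) ^ 2 + ((ζ 1) ^ 2 + (ζ 2) ^ 2))

/-- The symbol `exp (i t φ)` of the solution operator at time `t`. Mathlib's Fourier transform has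
the kernel `exp (-2 π i ⟨x, ζ⟩)`, so that `-i ∂` corresponds to multiplication by `2 π ζ`. -/
noncomputable def zkSymbol (t : ℝ) (ζ : Space3) : ℂ :=
  Complex.exp (Complex.I * ((t * zkPhase ((2 * Real.pi) • ζ) : ℝ) : ℂ))

/-- The solution operator `U_φ(t) = exp (-t ∂ₓ Δ)` of the linear Zakharov-Kuznetsov equation
`u_t + ∂ₓ Δ u = 0` on `ℝ³`, acting on tempered distributions. -/
noncomputable def zkFlow (t : ℝ) : 𝓢'(Space3, ℂ) →L[ℂ] 𝓢'(Space3, ℂ) :=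
  TemperedDistribution.fourierMultiplierCLM ℂ (zkSymbol t)

/-- The symbol `⟨ξ⟩ ^ s = (1 + ξ²) ^ (s / 2)`. -/
noncomputable def bracketSymbol (s : ℝ) (ζ : Space3) : ℂ :=
  (((1 + (2 * Real.pi * ζ 0) ^ 2) ^ (s / 2) : ℝ) : ℂ)

/-- The operator `⟨Dₓ⟩ ^ s` on tempered distributions. -/
noncomputable def bracketDx (s : ℝ) : 𝓢'(Space3, ℂ) →L[ℂ] 𝓢'(Space3, ℂ) :=
  TemperedDistribution.fourierMultiplierCLM ℂ (bracketSymbol s)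

/-- The tempered distribution `T` is given by the locally integrable function `f`. Test functions
with compact support are dense in the Schwartz space, so `f` determines `T`. -/
def IsGivenBy (T : 𝓢'(Space3, ℂ)) (f : Space3 → ℂ) : Prop :=
  LocallyIntegrable f volume ∧
    ∀ ψ : 𝓢(Space3, ℂ), HasCompactSupport (ψ : Space3 → ℂ) → T ψ = ∫ x, ψ x * f x

/-- `g = D_x ^ σ T` with `g ∈ L²(ℝ³)`: the Fourier transform of `T` is a locally integrable
function, and `ĝ(ξ, η) = |ξ| ^ σ T̂(ξ, η)` almost everywhere. (The plane `ξ = 0`, where the symbol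
may be singular, is a null set.) -/
def IsDxPow (σ : ℝ) (T : 𝓢'(Space3, ℂ)) (g : Lp ℂ 2 (volume : Measure Space3)) : Prop :=
  ∃ f : Space3 → ℂ, IsGivenBy (𝓕 T) f ∧
    ((𝓕 g : Lp ℂ 2 (volume : Measure Space3)) : Space3 → ℂ) =ᵐ[volume]
      fun ζ => ((|2 * Real.pi * ζ 0| ^ σ : ℝ) : ℂ) * f ζ

/-- The measurable function `u = u(t, (x, y))` on space-time is the free solution `U_φ u₀`: for
almost every time `t` the tempered distribution `U_φ(t) u₀` is given by `u(t, ·)`. This determines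
`u` almost everywhere on `ℝ × ℝ³`. -/
def IsFreeSolution (u : ℝ × Space3 → ℂ) (u₀ : 𝓢'(Space3, ℂ)) : Prop :=
  AEStronglyMeasurable u volume ∧ ∀ᵐ t : ℝ, IsGivenBy (zkFlow t u₀) (fun z => u (t, z))

/-! The two symbols above have temperate growth, so that the Fourier multipliers are the
intended ones. -/

lemma hasTemperateGrowth_exp_I_mul :
    Function.HasTemperateGrowth (fun r : ℝ => Complex.exp (Complex.I * (r : ℂ))) := by
  have hd : ∀ n : ℕ, iteratedDeriv n (fun r : ℝ => Complex.exp (Complex.I * (r : ℂ)))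
      = fun r : ℝ => Complex.I ^ n * Complex.exp (Complex.I * (r : ℂ)) := by
    intro n
    induction n with
    | zero => simp
    | succ k ih =>
      rw [iteratedDeriv_succ, ih]
      funext r
      have h1 : HasDerivAt (fun r : ℝ => Complex.I * (r : ℂ)) Complex.I r := by
        simpa using (Complex.ofRealCLM.hasDerivAt (x := r)).const_mul Complex.I
      have h2 := (h1.cexp).const_mul (Complex.I ^ k)
      rw [h2.deriv]
      ring
  refine ⟨?_, fun n => ⟨0, 1, fun r => ?_⟩⟩
  · have : ContDiff ℝ ((⊤ : ℕ∞) : WithTop ℕ∞)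
        (fun r : ℝ => Complex.I * Complex.ofRealCLM r) := by fun_prop
    exact this.cexp
  · rw [norm_iteratedFDeriv_eq_norm_iteratedDeriv, hd n]
    have : ‖Complex.exp (Complex.I * (r : ℂ))‖ = 1 := by
      rw [mul_comm]; exact Complex.norm_exp_ofReal_mul_I r
    simp [this]

lemma hasTemperateGrowth_coord (i : Fin 3) :
    Function.HasTemperateGrowth (fun ζ : Space3 => ζ i) :=
  (EuclideanSpace.proj i : Space3 →L[ℝ] ℝ).hasTemperateGrowth

lemma hasTemperateGrowth_zkSymbol (t : ℝ) : Function.HasTemperateGrowth (zkSymbol t) := by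
  have h : Function.HasTemperateGrowth
      (fun ζ : Space3 => t * zkPhase ((2 * Real.pi) • ζ)) := by
    have h0 := hasTemperateGrowth_coord 0
    have h1 := hasTemperateGrowth_coord 1
    have h2 := hasTemperateGrowth_coord 2
    simp only [zkPhase, PiLp.smul_apply, smul_eq_mul]
    fun_prop
  exact hasTemperateGrowth_exp_I_mul.comp h

lemma hasTemperateGrowth_bracketSymbol (s : ℝ) :
    Function.HasTemperateGrowth (bracketSymbol s) := by
  have h0 := hasTemperateGrowth_coord 0
  have h : Function.HasTemperateGrowth (fun ζ : Space3 => 2 * Real.pi * ζ 0) := by fun_prop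
  have h1 := (Function.hasTemperateGrowth_one_add_norm_sq_rpow ℝ (s / 2)).comp h
  have h2 := Function.Complex.hasTemperateGrowth_ofReal.comp h1
  have e : bracketSymbol s = Complex.ofReal ∘ ((fun x : ℝ => (1 + ‖x‖ ^ 2) ^ (s / 2)) ∘
      fun ζ : Space3 => 2 * Real.pi * ζ 0) := by
    funext ζ
    simp [bracketSymbol]
  rw [e]
  exact h2

/-! ### A change of variables for the resonance function -/

/-! A product of two free waves with Fourier data `f`, `g` has as space-time Fourier transform the
image of `f ⊗ g` under `(ζ₁, ζ₂) ↦ (φ(ζ₁) + φ(ζ₂), ζ₁ + ζ₂)`. By duality, Plancherel and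
Cauchy–Schwarz, the bilinear estimate with weights `α`, `β` follows once the image of the measure
`α⁻² β⁻² dζ₁ dζ₂` has a bounded density (`lintegral_lintegral_zkFreq_add_le`).

Let both `ξ`-frequencies be positive, with sum `ξ`. For fixed `ζ₁ + ζ₂` and `ξ₁`, the phase sum is a
constant plus `(2π)² ξ` times a squared distance in the plane of `η₁`. Polar coordinates therefore
give it the density at most `1/(4πξ)`, and it remains to bound `(1/(4πξ)) ∫₀^ξ α(x)⁻² β(ξ-x)⁻² dx`.
Trivial weights give `1/(4π)`. For `α = |ξ|^(-1/2)` the factor `α⁻²` cancels `1/ξ`, leaving `∫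
⟨x⟩^(-2s) dx`, finite for `s > 1/2`. Since `φ` is odd, complex conjugation reduces the other signs
to this case. The `L⁴` bound is the unweighted estimate for `u · u`.

Solutions for general data are limits of waves with Fourier data truncated to balls. The local
bounds this requires come from the bilinear estimate itself, applied with a second wave that does
not vanish near a given point. Fatou's lemma passes the estimate to the limit
(`IsTruncationLimit.lintegral_mul_sq_le`), and `IsFreeSolution.ae_eq` carries it to every
representative. -/

lemma lintegral_comp_const_add_mul_sq_le {G : ℝ → ℝ≥0∞} (α : ℝ) {c : ℝ}
    (hc : 0 < c) :
    ∫⁻ r in Set.Ioi (0 : ℝ), ENNReal.ofReal r * G (α + c * r ^ 2) ≤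
      ENNReal.ofReal (1 / (2 * c)) * ∫⁻ τ, G τ := by
  have hinj : Set.InjOn (fun r : ℝ => α + c * r ^ 2) (Set.Ioi 0) := by
    intro x hx y hy hxy
    have h1 : x ^ 2 = y ^ 2 := by
      have : c * x ^ 2 = c * y ^ 2 := by simpa using hxy
      exact mul_left_cancel₀ hc.ne' this
    exact (sq_eq_sq₀ (le_of_lt hx) (le_of_lt hy)).1 h1
  have hd : ∀ x ∈ Set.Ioi (0 : ℝ), HasDerivWithinAt (fun r : ℝ => α + c * r ^ 2)
      (2 * c * x) (Set.Ioi 0) x := by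
    intro x _
    have := (((hasDerivAt_pow 2 x).const_mul c).const_add α).hasDerivWithinAt (s := Set.Ioi 0)
    convert! this using 1
    simp; ring
  have key := lintegral_image_eq_lintegral_abs_deriv_mul measurableSet_Ioi hd hinj G
  calc ∫⁻ r in Set.Ioi (0 : ℝ), ENNReal.ofReal r * G (α + c * r ^ 2)
      = ∫⁻ r in Set.Ioi (0 : ℝ), ENNReal.ofReal (1 / (2 * c)) *
          (ENNReal.ofReal |2 * c * r| * G (α + c * r ^ 2)) := by
        refine setLIntegral_congr_fun measurableSet_Ioi fun r hr => ?_
        have hr' : (0 : ℝ) < r := hr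
        rw [← mul_assoc, ← ENNReal.ofReal_mul (by positivity), abs_of_pos (by positivity)]
        congr 2
        field_simp
    _ = ENNReal.ofReal (1 / (2 * c)) * ∫⁻ τ in (fun r : ℝ => α + c * r ^ 2) '' Set.Ioi 0, G τ := by
        rw [key, lintegral_const_mul' _ _ ENNReal.ofReal_ne_top]
    _ ≤ _ := by
        gcongr
        exact Measure.restrict_le_self

/-- In polar coordinates about `(p, q)`, the substitution `τ = α + c r²` turns `r dr` into
`dτ/(2c)`, and the angle contributes `2π`. The bound does not see `α`, `p`, `q`. -/
lemma lintegral_comp_const_add_mul_normSq_le {G : ℝ → ℝ≥0∞} (hG : Measurable G) (α p q : ℝ)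
    {c : ℝ} (hc : 0 < c) :
    ∫⁻ w : ℝ × ℝ, G (α + c * ((w.1 - p) ^ 2 + (w.2 - q) ^ 2)) ≤
      ENNReal.ofReal (Real.pi / c) * ∫⁻ τ, G τ := by
  have h1 : ∫⁻ w : ℝ × ℝ, G (α + c * ((w.1 - p) ^ 2 + (w.2 - q) ^ 2)) =
      ∫⁻ w : ℝ × ℝ, G (α + c * (w.1 ^ 2 + w.2 ^ 2)) :=
    lintegral_sub_right_eq_self (fun w : ℝ × ℝ => G (α + c * (w.1 ^ 2 + w.2 ^ 2))) (p, q)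
  rw [h1, ← lintegral_comp_polarCoord_symm, polarCoord_target, Measure.volume_eq_prod,
    ← Measure.prod_restrict, lintegral_prod]
  · have : ∀ r θ : ℝ, ENNReal.ofReal (r, θ).1 • G (α + c * ((polarCoord.symm (r, θ)).1 ^ 2 +
        (polarCoord.symm (r, θ)).2 ^ 2)) = ENNReal.ofReal r * G (α + c * r ^ 2) := by
      intro r θ
      simp only [polarCoord_symm_apply, smul_eq_mul]
      congr 4
      nlinarith [Real.sin_sq_add_cos_sq θ]
    simp only [this, lintegral_const, Measure.restrict_apply MeasurableSet.univ, Set.univ_inter,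
      Real.volume_Ioo]
    rw [lintegral_mul_const']
    · calc _ ≤ (ENNReal.ofReal (1 / (2 * c)) * ∫⁻ τ, G τ) *
            ENNReal.ofReal (Real.pi - -Real.pi) := by
            gcongr; exact lintegral_comp_const_add_mul_sq_le α hc
        _ = _ := by
          rw [mul_right_comm, ← ENNReal.ofReal_mul (by positivity)]
          congr 2
          field_simp; ring
    · exact ENNReal.ofReal_ne_top
  · have hm : Measurable (polarCoord.symm : ℝ × ℝ → ℝ × ℝ) :=
      continuous_polarCoord_symm.measurable
    exact (by fun_prop : Measurable _).aemeasurable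

/-- `ℝ³` as `ℝ × ℝ²`. -/
noncomputable def spaceProdEquiv : Space3 ≃ᵐ ℝ × (ℝ × ℝ) :=
  (MeasurableEquiv.toLp 2 (Fin 3 → ℝ)).symm.trans <|
    (MeasurableEquiv.piFinSuccAbove (fun _ : Fin 3 => ℝ) 0).trans <|
      (MeasurableEquiv.refl ℝ).prodCongr MeasurableEquiv.finTwoArrow

lemma spaceProdEquiv_apply (ζ : Space3) : spaceProdEquiv ζ = (ζ 0, (ζ 1, ζ 2)) := rfl

lemma measurePreserving_spaceProdEquiv : MeasurePreserving spaceProdEquiv := by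
  refine (EuclideanSpace.volume_preserving_symm_measurableEquiv_toLp (Fin 3)).trans ?_
  refine (volume_preserving_piFinSuccAbove (fun _ : Fin 3 => ℝ) 0).trans ?_
  exact (MeasurePreserving.id volume).prod (volume_preserving_finTwoArrow ℝ)

lemma lintegral_space_eq {F : ℝ → ℝ → ℝ → ℝ≥0∞}
    (hF : Measurable fun p : ℝ × (ℝ × ℝ) => F p.1 p.2.1 p.2.2) :
    ∫⁻ ζ : Space3, F (ζ 0) (ζ 1) (ζ 2) = ∫⁻ x, ∫⁻ w : ℝ × ℝ, F x w.1 w.2 := by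
  have := measurePreserving_spaceProdEquiv.lintegral_comp hF
  simp only [spaceProdEquiv_apply] at this
  rw [this, Measure.volume_eq_prod, lintegral_prod _ hF.aemeasurable]

/-- The dispersion relation `φ(2πζ) / 2π`, in the normalization of Mathlib's Fourier transform. -/
noncomputable def zkFreq (ζ : Space3) : ℝ :=
  (2 * Real.pi) ^ 2 * (ζ 0 * ((ζ 0) ^ 2 + ((ζ 1) ^ 2 + (ζ 2) ^ 2)))

lemma continuous_zkFreq : Continuous zkFreq := by
  unfold zkFreq
  fun_prop

lemma zkFreq_neg (ζ : Space3) : zkFreq (-ζ) = -zkFreq ζ := by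
  simp [zkFreq]

/-- The quadratic part in `η` has coefficient `(2π)² (x + (ζ 0 - x)) = (2π)² ζ 0`, independent of
`x`. Completing the square moves the centre to `((ζ 0 - x) / ζ 0) η`, and `π / ((2π)² ζ 0) = 1 / (4π
ζ 0)`. -/
lemma lintegral_zkFreq_add_zkFreq_le {G : ℝ → ℝ≥0∞} (hG : Measurable G) {κ : ℝ → ℝ≥0∞}
    (hκ : Measurable κ) (ζ : Space3) (hζ : 0 < ζ 0) :
    ∫⁻ ω : Space3, (Set.Ioo 0 (ζ 0)).indicator κ (ω 0) * G (zkFreq ω + zkFreq (ζ - ω)) ≤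
      ENNReal.ofReal (1 / (4 * Real.pi * ζ 0)) * (∫⁻ x in Set.Ioo 0 (ζ 0), κ x) * ∫⁻ τ, G τ := by
  have hκ' : Measurable ((Set.Ioo 0 (ζ 0)).indicator κ) := hκ.indicator measurableSet_Ioo
  set R : ℝ → ℝ → ℝ → ℝ := fun x y₁ y₂ => (2 * Real.pi) ^ 2 *
    (x * (x ^ 2 + (y₁ ^ 2 + y₂ ^ 2))) + (2 * Real.pi) ^ 2 *
      ((ζ 0 - x) * ((ζ 0 - x) ^ 2 + ((ζ 1 - y₁) ^ 2 + (ζ 2 - y₂) ^ 2))) with hR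
  have h1 := lintegral_space_eq (F := fun x y₁ y₂ =>
    (Set.Ioo 0 (ζ 0)).indicator κ x * G (R x y₁ y₂)) (by
      simp only [hR]
      fun_prop)
  have h2 : ∀ ω : Space3, zkFreq ω + zkFreq (ζ - ω) = R (ω 0) (ω 1) (ω 2) := fun ω => rfl
  simp only [h2]
  rw [h1]
  have h3 : ∀ x : ℝ, ∫⁻ w : ℝ × ℝ, (Set.Ioo 0 (ζ 0)).indicator κ x * G (R x w.1 w.2) ≤
      (Set.Ioo 0 (ζ 0)).indicator κ x * (ENNReal.ofReal (1 / (4 * Real.pi * ζ 0)) * ∫⁻ τ, G τ) := by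
    intro x
    rw [lintegral_const_mul _ (by simp only [hR]; fun_prop)]
    gcongr
    have h4 : ∀ w : ℝ × ℝ, R x w.1 w.2 = ((2 * Real.pi) ^ 2 * (x ^ 3 + (ζ 0 - x) ^ 3 +
        x * (ζ 0 - x) / ζ 0 * ((ζ 1) ^ 2 + (ζ 2) ^ 2))) + ((2 * Real.pi) ^ 2 * ζ 0) *
        ((w.1 - (ζ 0 - x) / ζ 0 * ζ 1) ^ 2 + (w.2 - (ζ 0 - x) / ζ 0 * ζ 2) ^ 2) := by
      intro w
      simp only [hR]
      field_simp
      ring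
    simp only [h4]
    refine (lintegral_comp_const_add_mul_normSq_le hG _ _ _ (by positivity)).trans_eq ?_
    congr 2
    have := Real.pi_pos
    field_simp
    ring
  calc _ ≤ _ := lintegral_mono h3
    _ = _ := by
      rw [lintegral_mul_const _ hκ', lintegral_indicator measurableSet_Ioo]
      ring

/-- The map `(ζ₁, ζ₂) ↦ (φ(ζ₁) + φ(ζ₂), ζ₁ + ζ₂)` on positive frequencies: the image of a weighted
Lebesgue measure has a bounded density. -/
lemma lintegral_lintegral_zkFreq_add_le {F : ℝ × Space3 → ℝ≥0∞} (hF : Measurable F)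
    {κ₁ κ₂ : ℝ → ℝ≥0∞} (hκ₁ : Measurable κ₁) (hκ₂ : Measurable κ₂) {A : ℝ≥0∞}
    (hA : ∀ ξ : ℝ, 0 < ξ →
      ENNReal.ofReal (1 / (4 * Real.pi * ξ)) * (∫⁻ x in Set.Ioo 0 ξ, κ₁ x * κ₂ (ξ - x)) ≤ A) :
    ∫⁻ ζ₁ : Space3, ∫⁻ ζ₂ : Space3, (Set.Ioi 0).indicator κ₁ (ζ₁ 0) *
      (Set.Ioi 0).indicator κ₂ (ζ₂ 0) * F (zkFreq ζ₁ + zkFreq ζ₂, ζ₁ + ζ₂) ≤ A * ∫⁻ p, F p := by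
  have hq := continuous_zkFreq.measurable
  have hκ₁' : Measurable ((Set.Ioi 0).indicator κ₁) := hκ₁.indicator measurableSet_Ioi
  have hκ₂' : Measurable ((Set.Ioi 0).indicator κ₂) := hκ₂.indicator measurableSet_Ioi
  have h1 : ∀ ζ₁ : Space3, ∫⁻ ζ₂ : Space3, (Set.Ioi 0).indicator κ₁ (ζ₁ 0) *
      (Set.Ioi 0).indicator κ₂ (ζ₂ 0) * F (zkFreq ζ₁ + zkFreq ζ₂, ζ₁ + ζ₂) =
      ∫⁻ ζ : Space3, (Set.Ioi 0).indicator κ₁ (ζ₁ 0) *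
      (Set.Ioi 0).indicator κ₂ (ζ 0 - ζ₁ 0) * F (zkFreq ζ₁ + zkFreq (ζ - ζ₁), ζ) := by
    intro ζ₁
    rw [← lintegral_sub_right_eq_self _ ζ₁]
    simp
  simp only [h1]
  rw [lintegral_lintegral_swap (by fun_prop), Measure.volume_eq_prod, lintegral_prod_symm' _ hF,
    ← lintegral_const_mul _ (by fun_prop)]
  refine lintegral_mono fun ζ => ?_
  have h2 : ∀ ζ₁ : Space3, (Set.Ioi 0).indicator κ₁ (ζ₁ 0) *
      (Set.Ioi 0).indicator κ₂ (ζ 0 - ζ₁ 0) =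
        (Set.Ioo 0 (ζ 0)).indicator (fun x => κ₁ x * κ₂ (ζ 0 - x)) (ζ₁ 0) := by
    intro ζ₁
    by_cases h : 0 < ζ₁ 0 <;> by_cases h' : ζ₁ 0 < ζ 0 <;> simp [Set.indicator, h, h']
  simp only [h2]
  by_cases hζ : 0 < ζ 0
  · refine (lintegral_zkFreq_add_zkFreq_le (G := fun τ => F (τ, ζ)) (by fun_prop)
      (κ := fun x => κ₁ x * κ₂ (ζ 0 - x)) (by fun_prop) ζ hζ).trans ?_
    gcongr
    exact hA _ hζ
  · rw [Set.Ioo_eq_empty hζ]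
    simp

/-! ### Plancherel's theorem for integrable functions -/

lemma ae_eq_of_integral_schwartz_mul_eq {V : Type*} [NormedAddCommGroup V] [NormedSpace ℝ V]
    [FiniteDimensional ℝ V] [MeasurableSpace V] [BorelSpace V] {μ : Measure V} {f f' : V → ℂ}
    (hf : LocallyIntegrable f μ) (hf' : LocallyIntegrable f' μ)
    (h : ∀ ψ : 𝓢(V, ℂ), HasCompactSupport (ψ : V → ℂ) → ∫ x, ψ x * f x ∂μ = ∫ x, ψ x * f' x ∂μ) :
    f =ᵐ[μ] f' := by
  refine ae_eq_of_integral_contDiff_smul_eq hf hf' fun g hg hgs => ?_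
  have hs : HasCompactSupport (fun x => (g x : ℂ)) := hgs.comp_left Complex.ofReal_zero
  have hc : ContDiff ℝ ((⊤ : ℕ∞) : WithTop ℕ∞) (fun x => (g x : ℂ)) :=
    Complex.ofRealCLM.contDiff.comp hg
  simp only [Complex.real_smul]
  exact h (hs.toSchwartzMap hc) hs

section Plancherel

variable {V : Type*} [NormedAddCommGroup V] [InnerProductSpace ℝ V] [FiniteDimensional ℝ V]
  [MeasurableSpace V] [BorelSpace V]

lemma continuous_fourier_of_integrable {f : V → ℂ} (hf : Integrable f) : Continuous (𝓕 f) :=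
  VectorFourier.fourierIntegral_continuous Real.continuous_fourierChar
    (by exact continuous_inner) hf

lemma integral_schwartz_mul_fourier {f : V → ℂ} (hf : Integrable f) (ψ : 𝓢(V, ℂ)) :
    ∫ x, ψ x * 𝓕 f x = ∫ x, (𝓕 ψ) x * f x := by
  have := VectorFourier.integral_fourierIntegral_smul_eq_flip (L := innerₗ V)
    (μ := volume) (ν := volume)
    Real.continuous_fourierChar continuous_inner ψ.integrable hf
  simp only [flip_innerₗ, smul_eq_mul] at this
  exact this.symm

/-- Identifies the abstract `L²` Fourier transform with the Fourier integral on `L¹ ∩ L²`: both give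
the same pairing with every Schwartz function. -/
lemma fourier_toLp_ae_eq {f : V → ℂ} (hf : Integrable f) (hf2 : MemLp f 2 volume) :
    ((𝓕 (hf2.toLp f) : Lp ℂ 2 (volume : Measure V)) : V → ℂ) =ᵐ[volume] 𝓕 f := by
  refine ae_eq_of_integral_schwartz_mul_eq ((Lp.memLp _).locallyIntegrable one_le_two)
    (continuous_fourier_of_integrable hf).locallyIntegrable fun ψ _ => ?_
  have h1 := congrArg (fun T : 𝓢'(V, ℂ) => T ψ)
    (Lp.fourier_toTemperedDistribution_eq (hf2.toLp f))
  simp only [TemperedDistribution.fourier_apply, Lp.toTemperedDistribution_apply,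
    smul_eq_mul] at h1
  rw [← h1, integral_schwartz_mul_fourier hf]
  refine integral_congr_ae ?_
  filter_upwards [hf2.coeFn_toLp] with x hx
  rw [hx]

lemma lintegral_enorm_sq_eq_eLpNorm_sq {α : Type*} [MeasurableSpace α] {μ : Measure α}
    (f : α → ℂ) : ∫⁻ x, ‖f x‖ₑ ^ 2 ∂μ = eLpNorm f 2 μ ^ 2 := by
  have := eLpNorm_nnreal_pow_eq_lintegral (f := f) (μ := μ) (p := 2) (by norm_num)
  norm_num at this
  exact_mod_cast this.symm

lemma lintegral_enorm_fourier_sq {f : V → ℂ} (hf : Integrable f) (hf2 : MemLp f 2 volume) :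
    ∫⁻ x, ‖𝓕 f x‖ₑ ^ 2 = ∫⁻ x, ‖f x‖ₑ ^ 2 := by
  rw [lintegral_enorm_sq_eq_eLpNorm_sq, lintegral_enorm_sq_eq_eLpNorm_sq,
    ← eLpNorm_congr_ae (fourier_toLp_ae_eq hf hf2), ← eLpNorm_congr_ae hf2.coeFn_toLp,
    ← Lp.enorm_def, ← Lp.enorm_def]
  congr 1
  rw [enorm_eq_iff_norm_eq, Lp.norm_fourier_eq]

end Plancherel

/-! ### Plancherel on space-time, and Cauchy–Schwarz. -/

/-- The space-time Fourier integral, with the kernel `exp (2πi(tτ + ⟨z, ζ⟩))`. -/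
noncomputable def spaceTimeFourier (H : ℝ × Space3 → ℂ) (q : ℝ × Space3) : ℂ :=
  ∫ p : ℝ × Space3, Real.fourierChar (p.1 * q.1 + inner ℝ p.2 q.2) • H p

/-- The product `ℝ × Space3` carries the sup norm, so Plancherel is borrowed from its Euclidean
version `WithLp 2`. The positive sign in the kernel accounts for the reflection. -/
lemma spaceTimeFourier_eq (H : ℝ × Space3 → ℂ) (q : ℝ × Space3) :
    spaceTimeFourier H q =
      𝓕 (fun x : WithLp 2 (ℝ × Space3) => H (WithLp.ofLp x)) (-WithLp.toLp 2 q) := by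
  rw [← Real.fourierInv_eq_fourier_neg, Real.fourierInv_eq]
  have := (WithLp.volume_preserving_symm_measurableEquiv_toLp_prod ℝ Space3).integral_comp
    (MeasurableEquiv.measurableEmbedding _)
    (fun p => Real.fourierChar (p.1 * q.1 + inner ℝ p.2 q.2) • H p)
  rw [spaceTimeFourier, ← this]
  refine integral_congr_ae (.of_forall fun x => ?_)
  simp [WithLp.prod_inner_apply, mul_comm]

lemma continuous_spaceTimeFourier {H : ℝ × Space3 → ℂ} (hH : Integrable H) :
    Continuous (spaceTimeFourier H) := by
  have h1 : Integrable (fun x : WithLp 2 (ℝ × Space3) => H (WithLp.ofLp x)) :=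
    (WithLp.volume_preserving_ofLp ℝ Space3).integrable_comp_of_integrable hH
  have := (continuous_fourier_of_integrable h1).comp
    ((WithLp.prod_continuous_toLp 2 ℝ Space3).neg)
  exact (funext fun q => (spaceTimeFourier_eq H q)) ▸ this

lemma lintegral_enorm_spaceTimeFourier_sq {H : ℝ × Space3 → ℂ} (hH : Integrable H)
    (hH2 : MemLp H 2 volume) :
    ∫⁻ q, ‖spaceTimeFourier H q‖ₑ ^ 2 = ∫⁻ p, ‖H p‖ₑ ^ 2 := by
  have hm := WithLp.volume_preserving_symm_measurableEquiv_toLp_prod ℝ Space3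
  have h1 : Integrable (fun x : WithLp 2 (ℝ × Space3) => H (WithLp.ofLp x)) :=
    (WithLp.volume_preserving_ofLp ℝ Space3).integrable_comp_of_integrable hH
  have h2 : MemLp (fun x : WithLp 2 (ℝ × Space3) => H (WithLp.ofLp x)) 2 volume :=
    hH2.comp_measurePreserving (WithLp.volume_preserving_ofLp ℝ Space3)
  rw [← hm.lintegral_comp_emb (MeasurableEquiv.measurableEmbedding _),
    ← hm.lintegral_comp_emb (MeasurableEquiv.measurableEmbedding _)]
  simp only [spaceTimeFourier_eq]
  refine Eq.trans ?_ (lintegral_enorm_fourier_sq h1 h2)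
  rw [← lintegral_neg_eq_self]
  simp

lemma sq_lintegral_mul_le {α : Type*} [MeasurableSpace α] {μ : Measure α} {f g : α → ℝ≥0∞}
    (hf : AEMeasurable f μ) (hg : AEMeasurable g μ) :
    (∫⁻ x, f x * g x ∂μ) ^ 2 ≤ (∫⁻ x, f x ^ 2 ∂μ) * ∫⁻ x, g x ^ 2 ∂μ := by
  have h := ENNReal.lintegral_mul_le_Lp_mul_Lq μ Real.HolderConjugate.two_two hf hg
  have h2 : ∀ a : ℝ≥0∞, (a ^ (1 / 2 : ℝ)) ^ 2 = a := fun a => by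
    rw [← ENNReal.rpow_natCast, ← ENNReal.rpow_mul]; norm_num
  calc _ ≤ _ := pow_le_pow_left' h 2
    _ = _ := by simp only [mul_pow, h2, ENNReal.rpow_two]

/-! ### The free evolution of integrable Fourier data -/

/-- The solution of the linear Zakharov-Kuznetsov equation with initial Fourier transform `f`. -/
noncomputable def freeWave (f : Space3 → ℂ) (p : ℝ × Space3) : ℂ :=
  ∫ ζ : Space3, Real.fourierChar (p.1 * zkFreq ζ + inner ℝ p.2 ζ) • f ζ

lemma continuous_freePhase :
    Continuous fun x : (ℝ × Space3) × Space3 => x.1.1 * zkFreq x.2 + inner ℝ x.1.2 x.2 := by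
  have := continuous_zkFreq
  fun_prop

lemma integrable_fourierChar_smul {α : Type*} [MeasurableSpace α] {μ : Measure α} {θ : α → ℝ}
    (hθ : Measurable θ) {f : α → ℂ} (hf : Integrable f μ) :
    Integrable (fun x => Real.fourierChar (θ x) • f x) μ := by
  refine hf.congr' ?_ (.of_forall fun x => (Circle.norm_smul _ _).symm)
  have h : Measurable fun x => (Real.fourierChar (θ x) : ℂ) :=
    (continuous_subtype_val.comp Real.continuous_fourierChar).measurable.comp hθ
  simp only [Circle.smul_def]
  exact h.aestronglyMeasurable.smul hf.1

lemma measurable_freePhase (p : ℝ × Space3) :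
    Measurable fun ζ : Space3 => p.1 * zkFreq ζ + inner ℝ p.2 ζ := by
  have := continuous_freePhase.comp (Continuous.prodMk_right p)
  exact this.measurable

lemma integrable_freeWave {f : Space3 → ℂ} (hf : Integrable f) (p : ℝ × Space3) :
    Integrable fun ζ : Space3 => Real.fourierChar (p.1 * zkFreq ζ + inner ℝ p.2 ζ) • f ζ :=
  integrable_fourierChar_smul (measurable_freePhase p) hf

lemma continuous_freeWave {f : Space3 → ℂ} (hf : Integrable f) : Continuous (freeWave f) := by
  refine continuous_of_dominated (fun p => (integrable_freeWave hf p).1)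
    (fun p => .of_forall fun ζ => (Circle.norm_smul _ _).le) hf.norm (.of_forall fun ζ => ?_)
  have h1 := continuous_freePhase.comp (Continuous.prodMk_left ζ)
  have := (continuous_subtype_val.comp Real.continuous_fourierChar).comp h1
  simp only [Circle.smul_def]
  exact this.smul continuous_const

lemma freeWave_add {f g : Space3 → ℂ} (hf : Integrable f) (hg : Integrable g) (p : ℝ × Space3) :
    freeWave (fun ζ => f ζ + g ζ) p = freeWave f p + freeWave g p := by
  simp only [freeWave, smul_add]
  exact integral_add (integrable_freeWave hf p) (integrable_freeWave hg p)

lemma freeWave_sub {f g : Space3 → ℂ} (hf : Integrable f) (hg : Integrable g) (p : ℝ × Space3) :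
    freeWave (fun ζ => f ζ - g ζ) p = freeWave f p - freeWave g p := by
  simp only [freeWave, smul_sub]
  exact integral_sub (integrable_freeWave hf p) (integrable_freeWave hg p)

lemma freeWave_congr_ae {f g : Space3 → ℂ} (h : f =ᵐ[volume] g) : freeWave f = freeWave g := by
  funext p
  refine integral_congr_ae ?_
  filter_upwards [h] with ζ hζ
  rw [hζ]

/-- Oddness of `zkFreq` makes the conjugate of a free wave a free wave again, with the frequency
support reflected. This turns negative `ξ` into positive `ξ`. -/
lemma freeWave_conj_neg (f : Space3 → ℂ) (p : ℝ × Space3) :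
    freeWave (fun ζ => (starRingEnd ℂ) (f (-ζ))) p = (starRingEnd ℂ) (freeWave f p) := by
  rw [freeWave, freeWave, ← integral_conj, ← integral_neg_eq_self]
  refine integral_congr_ae (.of_forall fun ζ => ?_)
  have : p.1 * zkFreq (-ζ) + inner ℝ p.2 (-ζ) = -(p.1 * zkFreq ζ + inner ℝ p.2 ζ) := by
    rw [zkFreq_neg, inner_neg_right]; ring
  simp only [neg_neg, this, AddChar.map_neg_eq_inv, Circle.smul_def, smul_eq_mul, map_mul,
    Circle.coe_inv_eq_conj]

/-- Duality between products of free solutions and the space-time Fourier transform. -/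
lemma integral_mul_freeWave_mul_freeWave {f g : Space3 → ℂ} {H : ℝ × Space3 → ℂ}
    (hf : Integrable f) (hg : Integrable g) (hH : Integrable H) :
    ∫ p, H p * (freeWave f p * freeWave g p) =
      ∫ z : Space3 × Space3, (f z.1 * g z.2) *
        spaceTimeFourier H (zkFreq z.1 + zkFreq z.2, z.1 + z.2) := by
  have h1 : ∀ p : ℝ × Space3, H p * (freeWave f p * freeWave g p) =
      ∫ z : Space3 × Space3, Real.fourierChar (p.1 * (zkFreq z.1 + zkFreq z.2) +
        inner ℝ p.2 (z.1 + z.2)) • (H p * (f z.1 * g z.2)) := by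
    intro p
    rw [freeWave, freeWave, ← integral_prod_mul, ← integral_const_mul, ← Measure.volume_eq_prod]
    refine integral_congr_ae (.of_forall fun z => ?_)
    have : p.1 * (zkFreq z.1 + zkFreq z.2) + inner ℝ p.2 (z.1 + z.2) =
      (p.1 * zkFreq z.1 + inner ℝ p.2 z.1) + (p.1 * zkFreq z.2 + inner ℝ p.2 z.2) := by
      rw [inner_add_right]; ring
    simp only [this, AddChar.map_add_eq_mul, Circle.smul_def, Circle.coe_mul, smul_eq_mul]
    ring
  simp only [h1]
  rw [integral_integral_swap]
  · refine integral_congr_ae (.of_forall fun z => ?_)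
    simp only [spaceTimeFourier]
    rw [← integral_const_mul]
    refine integral_congr_ae (.of_forall fun p => ?_)
    simp only [Circle.smul_def, smul_eq_mul]
    ring
  · have h2 : Integrable (fun x : (ℝ × Space3) × (Space3 × Space3) =>
        H x.1 * (f x.2.1 * g x.2.2)) (volume.prod volume) := hH.mul_prod (hf.mul_prod hg)
    refine integrable_fourierChar_smul (θ := fun x : (ℝ × Space3) × (Space3 × Space3) =>
      x.1.1 * (zkFreq x.2.1 + zkFreq x.2.2) + inner ℝ x.1.2 (x.2.1 + x.2.2)) ?_ h2
    have := continuous_zkFreq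
    exact Continuous.measurable (by fun_prop)

/-! ### The bilinear estimate for integrable Fourier data -/

/-- The square of the `L²` norm of `f` with the weight `α(ξ)`. -/
noncomputable def weightedSq (α : ℝ → ℝ≥0∞) (f : Space3 → ℂ) : ℝ≥0∞ :=
  ∫⁻ ζ : Space3, (α (ζ 0) * ‖f ζ‖ₑ) ^ 2

/-- Even weights `α`, `β` for which the bilinear estimate holds with the constant `A`. -/
structure AdmissibleWeights (α β : ℝ → ℝ≥0∞) (A : ℝ≥0∞) : Prop where
  measurable_left : Measurable α
  measurable_right : Measurable β
  even_left : ∀ x, α (-x) = α x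
  even_right : ∀ x, β (-x) = β x
  left_ne_zero : ∀ x, 0 < x → α x ≠ 0
  left_ne_top : ∀ x, 0 < x → α x ≠ ∞
  right_ne_zero : ∀ x, 0 < x → β x ≠ 0
  right_ne_top : ∀ x, 0 < x → β x ≠ ∞
  kernel_le : ∀ ξ : ℝ, 0 < ξ → ENNReal.ofReal (1 / (4 * Real.pi * ξ)) *
    (∫⁻ x in Set.Ioo 0 ξ, (α x)⁻¹ ^ 2 * (β (ξ - x))⁻¹ ^ 2) ≤ A

/-- Multiply and divide by `α β`, then apply Cauchy–Schwarz on `Space3 × Space3`. One factor splits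
into the two weighted norms. The other is controlled by the bounded image density, `kernel_le` being
exactly its hypothesis, followed by Plancherel for `H`. -/
lemma sq_lintegral_mul_spaceTimeFourier_le {α β : ℝ → ℝ≥0∞} {A : ℝ≥0∞}
    (h : AdmissibleWeights α β A) {f g : Space3 → ℂ} {H : ℝ × Space3 → ℂ}
    (hf : Integrable f) (hg : Integrable g) (hH : Integrable H) (hH2 : MemLp H 2 volume)
    (hf0 : ∀ ζ, ζ 0 ≤ 0 → f ζ = 0) (hg0 : ∀ ζ, ζ 0 ≤ 0 → g ζ = 0) :
    (∫⁻ z : Space3 × Space3, (‖f z.1‖ₑ * ‖g z.2‖ₑ) *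
      ‖spaceTimeFourier H (zkFreq z.1 + zkFreq z.2, z.1 + z.2)‖ₑ) ^ 2 ≤
      (weightedSq α f * weightedSq β g) * (A * ∫⁻ p, ‖H p‖ₑ ^ 2) := by
  have hα := h.measurable_left
  have hβ := h.measurable_right
  have hq := continuous_zkFreq.measurable
  have hF := (continuous_spaceTimeFourier hH).measurable
  -- The weights are inverted only on the half-line where they are known to be finite and nonzero;
  -- the supports of `f` and `g` make the extension by zero harmless.
  set κ₁ : ℝ → ℝ≥0∞ := (Set.Ioi 0).indicator fun x => (α x)⁻¹
  set κ₂ : ℝ → ℝ≥0∞ := (Set.Ioi 0).indicator fun x => (β x)⁻¹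
  have hκ₁ : Measurable κ₁ := hα.inv.indicator measurableSet_Ioi
  have hκ₂ : Measurable κ₂ := hβ.inv.indicator measurableSet_Ioi
  have h1 : ∀ z : Space3 × Space3, (‖f z.1‖ₑ * ‖g z.2‖ₑ) *
      ‖spaceTimeFourier H (zkFreq z.1 + zkFreq z.2, z.1 + z.2)‖ₑ =
      ((α (z.1 0) * ‖f z.1‖ₑ) * (β (z.2 0) * ‖g z.2‖ₑ)) * (κ₁ (z.1 0) * κ₂ (z.2 0) *
      ‖spaceTimeFourier H (zkFreq z.1 + zkFreq z.2, z.1 + z.2)‖ₑ) := by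
    intro z
    by_cases hz1 : 0 < z.1 0
    · by_cases hz2 : 0 < z.2 0
      · have e1 : κ₁ (z.1 0) = (α (z.1 0))⁻¹ := Set.indicator_of_mem (by exact hz1) _
        have e2 : κ₂ (z.2 0) = (β (z.2 0))⁻¹ := Set.indicator_of_mem (by exact hz2) _
        have e3 := ENNReal.mul_inv_cancel (h.left_ne_zero _ hz1) (h.left_ne_top _ hz1)
        have e4 := ENNReal.mul_inv_cancel (h.right_ne_zero _ hz2) (h.right_ne_top _ hz2)
        rw [e1, e2]
        calc _ = (α (z.1 0) * (α (z.1 0))⁻¹) * (β (z.2 0) * (β (z.2 0))⁻¹) *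
              ((‖f z.1‖ₑ * ‖g z.2‖ₑ) *
                ‖spaceTimeFourier H (zkFreq z.1 + zkFreq z.2, z.1 + z.2)‖ₑ) := by
              rw [e3, e4]; ring
          _ = _ := by ring
      · simp [hg0 _ (not_lt.1 hz2)]
    · simp [hf0 _ (not_lt.1 hz1)]
  have mf : AEMeasurable (fun ζ : Space3 => α (ζ 0) * ‖f ζ‖ₑ) :=
    (by fun_prop : Measurable fun ζ : Space3 => α (ζ 0)).aemeasurable.mul hf.1.enorm
  have mg : AEMeasurable (fun ζ : Space3 => β (ζ 0) * ‖g ζ‖ₑ) :=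
    (by fun_prop : Measurable fun ζ : Space3 => β (ζ 0)).aemeasurable.mul hg.1.enorm
  simp only [h1]
  refine (sq_lintegral_mul_le ?_ ?_).trans ?_
  · rw [Measure.volume_eq_prod]
    exact mf.comp_fst.mul mg.comp_snd
  · exact (by fun_prop : Measurable _).aemeasurable
  refine mul_le_mul' (le_of_eq ?_) ?_
  · simp only [mul_pow _ _ 2, Measure.volume_eq_prod Space3 Space3]
    rw [weightedSq, weightedSq, ← lintegral_prod_mul (mf.pow_const 2) (mg.pow_const 2)]
    simp only [mul_pow]
  · rw [← lintegral_enorm_spaceTimeFourier_sq hH hH2, Measure.volume_eq_prod Space3 Space3,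
      lintegral_prod _ (by fun_prop)]
    refine le_trans (le_of_eq ?_) (lintegral_lintegral_zkFreq_add_le
      (F := fun q => ‖spaceTimeFourier H q‖ₑ ^ 2) (by fun_prop)
      (κ₁ := fun x => (α x)⁻¹ ^ 2) (κ₂ := fun x => (β x)⁻¹ ^ 2) (by fun_prop) (by fun_prop)
      h.kernel_le)
    refine lintegral_congr fun ζ₁ => lintegral_congr fun ζ₂ => ?_
    simp only [κ₁, κ₂, Set.indicator, mul_pow]
    split_ifs <;> simp

/-- Duality with the product itself: `H` is its conjugate cut off to a ball, so the pairing equals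
the local energy `X`, and `X² ≤ W A X` with `W` the product of the weighted norms. The cutoff puts
`H` in `L¹ ∩ L²` and makes `X` finite, so that `X` can be divided out; the balls then exhaust
space-time. -/
lemma lintegral_freeWave_mul_sq_le_of_pos {α β : ℝ → ℝ≥0∞} {A : ℝ≥0∞}
    (h : AdmissibleWeights α β A) {f g : Space3 → ℂ}
    (hf : Integrable f) (hg : Integrable g)
    (hf0 : ∀ ζ, ζ 0 ≤ 0 → f ζ = 0) (hg0 : ∀ ζ, ζ 0 ≤ 0 → g ζ = 0) :
    ∫⁻ p, ‖freeWave f p * freeWave g p‖ₑ ^ 2 ≤ A * (weightedSq α f * weightedSq β g) := by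
  have hc : Continuous fun p => freeWave f p * freeWave g p :=
    (continuous_freeWave hf).mul (continuous_freeWave hg)
  have key : ∀ n : ℕ, ∫⁻ p in Metric.closedBall 0 n, ‖freeWave f p * freeWave g p‖ₑ ^ 2 ≤
      A * (weightedSq α f * weightedSq β g) := by
    intro n
    set B : Set (ℝ × Space3) := Metric.closedBall 0 n
    have hB : MeasurableSet B := Metric.isClosed_closedBall.measurableSet
    have hBc : IsCompact B := isCompact_closedBall _ _
    set H : ℝ × Space3 → ℂ :=
      B.indicator fun p => (starRingEnd ℂ) (freeWave f p * freeWave g p) with hHdef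
    have hcc : Continuous fun p => (starRingEnd ℂ) (freeWave f p * freeWave g p) :=
      Complex.continuous_conj.comp hc
    have hH : Integrable H := (hcc.continuousOn.integrableOn_compact hBc).integrable_indicator hB
    have hH2 : MemLp H 2 volume := by
      refine (memLp_two_iff_integrable_sq_norm hH.1).2 ?_
      have : (fun p => ‖H p‖ ^ 2) = B.indicator fun p => ‖freeWave f p * freeWave g p‖ ^ 2 := by
        funext p
        by_cases hp : p ∈ B <;> simp [H, hp]
      rw [this]
      exact ((by fun_prop : Continuous fun p => ‖freeWave f p * freeWave g p‖ ^ 2).continuousOn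
        |>.integrableOn_compact hBc).integrable_indicator hB
    have hX : ∫⁻ p, ‖H p‖ₑ ^ 2 = ∫⁻ p in B, ‖freeWave f p * freeWave g p‖ₑ ^ 2 := by
      rw [← lintegral_indicator hB]
      refine lintegral_congr fun p => ?_
      by_cases hp : p ∈ B <;> simp [H, hp]
    set X := ∫⁻ p in B, ‖freeWave f p * freeWave g p‖ₑ ^ 2 with hXdef
    have hXtop : X ≠ ∞ := by
      rw [← hX, lintegral_enorm_sq_eq_eLpNorm_sq]
      exact ENNReal.pow_ne_top hH2.2.ne
    have hXint : X = ‖∫ p, H p * (freeWave f p * freeWave g p)‖ₑ := by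
      have e1 : ∀ p, H p * (freeWave f p * freeWave g p) = ((‖H p‖ ^ 2 : ℝ) : ℂ) := by
        intro p
        by_cases hp : p ∈ B
        · simp only [H, Set.indicator_of_mem hp, RCLike.norm_conj, Complex.conj_mul']
          norm_cast
        · simp [H, hp]
      simp only [e1, integral_complex_ofReal]
      rw [← hX, ← ofReal_norm, Complex.norm_real, Real.norm_of_nonneg (by positivity),
        ofReal_integral_eq_lintegral_ofReal
          ((memLp_two_iff_integrable_sq_norm hH.1).1 hH2) (.of_forall fun p => by positivity)]
      refine lintegral_congr fun p => ?_
      rw [ENNReal.ofReal_pow (norm_nonneg _), ofReal_norm]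
    have h1 : X ^ 2 ≤ (weightedSq α f * weightedSq β g) * (A * X) := by
      rw [← hX]
      refine le_trans ?_ (sq_lintegral_mul_spaceTimeFourier_le h hf hg hH hH2 hf0 hg0)
      gcongr
      rw [hX, hXint, integral_mul_freeWave_mul_freeWave hf hg hH]
      refine (enorm_integral_le_lintegral_enorm _).trans_eq ?_
      simp only [enorm_mul]
    by_cases hX0 : X = 0
    · rw [hX0]; exact zero_le
    · rw [sq, ← mul_assoc, ENNReal.mul_le_mul_iff_left hX0 hXtop, mul_comm] at h1
      exact h1
  have hU : (⋃ n : ℕ, Metric.closedBall (0 : ℝ × Space3) n) = Set.univ :=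
    Metric.iUnion_closedBall_nat 0
  rw [← setLIntegral_univ, ← hU, setLIntegral_iUnion_of_directed]
  · exact iSup_le key
  · refine Monotone.directed_le fun m n hmn => Metric.closedBall_subset_closedBall ?_
    exact_mod_cast hmn

/-! ### Splitting by the sign of the `ξ`-frequency. -/

lemma volume_setOf_coord_eq_zero : volume {ζ : Space3 | ζ 0 = 0} = 0 := by
  have := Measure.addHaar_submodule (volume : Measure Space3)
    (LinearMap.ker (EuclideanSpace.proj 0 : Space3 →L[ℝ] ℝ).toLinearMap) (by
      intro h
      have h1 : (EuclideanSpace.single 0 (1 : ℝ) : Space3) ∈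
          LinearMap.ker (EuclideanSpace.proj 0 : Space3 →L[ℝ] ℝ).toLinearMap := h ▸ Submodule.mem_top
      simp at h1)
  convert! this using 1

lemma measurableSet_setOf_coord_pos : MeasurableSet {ζ : Space3 | 0 < ζ 0} :=
  measurableSet_lt measurable_const (by fun_prop)

lemma measurableSet_setOf_coord_neg : MeasurableSet {ζ : Space3 | ζ 0 < 0} :=
  measurableSet_lt (by fun_prop) measurable_const

lemma freeWave_eq_pos_add_neg {f : Space3 → ℂ} (hf : Integrable f) (p : ℝ × Space3) :
    freeWave f p = freeWave ({ζ | 0 < ζ 0}.indicator f) p +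
      freeWave ({ζ | ζ 0 < 0}.indicator f) p := by
  rw [← freeWave_add (hf.indicator measurableSet_setOf_coord_pos)
    (hf.indicator measurableSet_setOf_coord_neg)]
  refine congrFun (freeWave_congr_ae ?_) p
  have h0 : ∀ᵐ ζ : Space3, ζ 0 ≠ 0 := by
    rw [ae_iff]; simpa using volume_setOf_coord_eq_zero
  filter_upwards [h0] with ζ hζ
  rcases lt_or_gt_of_ne hζ with h | h <;> simp [Set.indicator, h, h.le]

lemma weightedSq_mono (α : ℝ → ℝ≥0∞) {f g : Space3 → ℂ} (h : ∀ ζ, ‖f ζ‖ₑ ≤ ‖g ζ‖ₑ) :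
    weightedSq α f ≤ weightedSq α g := by
  unfold weightedSq
  gcongr
  exact h _

lemma weightedSq_conj_neg {α : ℝ → ℝ≥0∞} (hα : ∀ x, α (-x) = α x) (f : Space3 → ℂ) :
    weightedSq α (fun ζ => (starRingEnd ℂ) (f (-ζ))) = weightedSq α f := by
  rw [weightedSq, weightedSq, ← lintegral_neg_eq_self]
  simp [hα]

lemma enorm_indicator_le {f : Space3 → ℂ} (s : Set Space3) (ζ : Space3) :
    ‖s.indicator f ζ‖ₑ ≤ ‖f ζ‖ₑ := by
  by_cases h : ζ ∈ s <;> simp [h]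

/-- Reflection reduces the four sign combinations to positive frequencies. -/
lemma exists_pos_freeWave_enorm_eq {α : ℝ → ℝ≥0∞} (hα : ∀ x, α (-x) = α x) {f : Space3 → ℂ}
    (hf : Integrable f) :
    ∃ f₁ f₂ : Space3 → ℂ, Integrable f₁ ∧ Integrable f₂ ∧ (∀ ζ, ζ 0 ≤ 0 → f₁ ζ = 0) ∧
      (∀ ζ, ζ 0 ≤ 0 → f₂ ζ = 0) ∧ weightedSq α f₁ ≤ weightedSq α f ∧
      weightedSq α f₂ ≤ weightedSq α f ∧
      ∀ p, ‖freeWave f p‖ₑ ≤ ‖freeWave f₁ p‖ₑ + ‖freeWave f₂ p‖ₑ := by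
  refine ⟨{ζ | 0 < ζ 0}.indicator f,
    fun ζ => (starRingEnd ℂ) ({ζ | ζ 0 < 0}.indicator f (-ζ)),
    hf.indicator measurableSet_setOf_coord_pos, ?_, ?_, ?_, ?_, ?_, ?_⟩
  · have := (hf.indicator measurableSet_setOf_coord_neg).comp_neg
    refine this.congr' ?_ (.of_forall fun ζ => ?_)
    · exact Complex.continuous_conj.comp_aestronglyMeasurable this.1
    · exact (RCLike.norm_conj _).symm
  · intro ζ hζ
    simp [hζ]
  · intro ζ hζ
    simp [hζ]
  · exact weightedSq_mono α fun ζ => enorm_indicator_le _ _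
  · rw [weightedSq_conj_neg hα]
    exact weightedSq_mono α fun ζ => enorm_indicator_le _ _
  · intro p
    rw [freeWave_eq_pos_add_neg hf, freeWave_conj_neg]
    refine (enorm_add_le _ _).trans_eq ?_
    congr 1
    rw [enorm_eq_iff_norm_eq, RCLike.norm_conj]

lemma sq_add_mul_add_le (a b c d : ℝ≥0∞) :
    ((a + b) * (c + d)) ^ 2 ≤
      4 * ((a * c) ^ 2 + (a * d) ^ 2 + (b * c) ^ 2 + (b * d) ^ 2) := by
  have h : ∀ x y : ℝ≥0∞, (x + y) ^ 2 ≤ 2 * (x ^ 2 + y ^ 2) := by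
    intro x y
    have := ENNReal.rpow_add_le_mul_rpow_add_rpow x y (p := 2) one_le_two
    norm_num at this
    exact this
  calc ((a + b) * (c + d)) ^ 2 = (a + b) ^ 2 * (c + d) ^ 2 := mul_pow _ _ _
    _ ≤ (2 * (a ^ 2 + b ^ 2)) * (2 * (c ^ 2 + d ^ 2)) := mul_le_mul' (h a b) (h c d)
    _ = _ := by ring

/-- The constant `16` is the factor `4` of `sq_add_mul_add_le` times the four sign combinations. -/
lemma lintegral_freeWave_mul_sq_le {α β : ℝ → ℝ≥0∞} {A : ℝ≥0∞}
    (h : AdmissibleWeights α β A) {f g : Space3 → ℂ} (hf : Integrable f) (hg : Integrable g) :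
    ∫⁻ p, ‖freeWave f p * freeWave g p‖ₑ ^ 2 ≤
      16 * A * (weightedSq α f * weightedSq β g) := by
  obtain ⟨f₁, f₂, if₁, if₂, zf₁, zf₂, wf₁, wf₂, ef⟩ :=
    exists_pos_freeWave_enorm_eq h.even_left hf
  obtain ⟨g₁, g₂, ig₁, ig₂, zg₁, zg₂, wg₁, wg₂, eg⟩ :=
    exists_pos_freeWave_enorm_eq h.even_right hg
  have c₁ := (continuous_freeWave if₁).measurable
  have c₂ := (continuous_freeWave if₂).measurable
  have c₃ := (continuous_freeWave ig₁).measurable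
  have c₄ := (continuous_freeWave ig₂).measurable
  have b : ∀ {f' g' : Space3 → ℂ}, Integrable f' → Integrable g' → (∀ ζ, ζ 0 ≤ 0 → f' ζ = 0) →
      (∀ ζ, ζ 0 ≤ 0 → g' ζ = 0) → weightedSq α f' ≤ weightedSq α f →
      weightedSq β g' ≤ weightedSq β g → ∫⁻ p, (‖freeWave f' p‖ₑ * ‖freeWave g' p‖ₑ) ^ 2 ≤
        A * (weightedSq α f * weightedSq β g) := by
    intro f' g' i j zi zj wi wj
    simp only [← enorm_mul]
    refine (lintegral_freeWave_mul_sq_le_of_pos h i j zi zj).trans ?_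
    gcongr
  calc ∫⁻ p, ‖freeWave f p * freeWave g p‖ₑ ^ 2
      ≤ ∫⁻ p, 4 * ((‖freeWave f₁ p‖ₑ * ‖freeWave g₁ p‖ₑ) ^ 2 +
        (‖freeWave f₁ p‖ₑ * ‖freeWave g₂ p‖ₑ) ^ 2 + (‖freeWave f₂ p‖ₑ * ‖freeWave g₁ p‖ₑ) ^ 2 +
        (‖freeWave f₂ p‖ₑ * ‖freeWave g₂ p‖ₑ) ^ 2) := by
        refine lintegral_mono fun p => le_trans ?_ (sq_add_mul_add_le _ _ _ _)
        rw [enorm_mul]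
        exact pow_le_pow_left' (mul_le_mul' (ef p) (eg p)) 2
    _ ≤ 4 * (A * (weightedSq α f * weightedSq β g) + A * (weightedSq α f * weightedSq β g) +
        A * (weightedSq α f * weightedSq β g) + A * (weightedSq α f * weightedSq β g)) := by
        rw [lintegral_const_mul _ (by fun_prop), lintegral_add_left (by fun_prop),
          lintegral_add_left (by fun_prop), lintegral_add_left (by fun_prop)]
        gcongr
        · exact b if₁ ig₁ zf₁ zg₁ wf₁ wg₁
        · exact b if₁ ig₂ zf₁ zg₂ wf₁ wg₂
        · exact b if₂ ig₁ zf₂ zg₁ wf₂ wg₁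
        · exact b if₂ ig₂ zf₂ zg₂ wf₂ wg₂
    _ = _ := by ring

/-! ### Compactly supported functions are dense in the Schwartz space -/

section Cutoff

variable {V : Type*} [NormedAddCommGroup V] [InnerProductSpace ℝ V] [FiniteDimensional ℝ V]

/-- `θ - 1` vanishes on the unit ball and has bounded derivatives, so a bound linear in `‖y‖` costs
nothing. At `y = x / (n + 1)` that linear factor becomes the decay `1 / (n + 1)`, at the price of
one power of `‖x‖`. -/
lemma exists_norm_iteratedFDeriv_sub_one_le (θ : ContDiffBump (0 : V)) (hθ : 1 ≤ θ.rIn) (i : ℕ) :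
    ∃ C : ℝ, 0 ≤ C ∧ ∀ y, ‖iteratedFDeriv ℝ i (fun y => θ y - 1) y‖ ≤ C * ‖y‖ := by
  have hθc : ContDiff ℝ ((⊤ : ℕ∞) : WithTop ℕ∞) θ := θ.contDiff
  set Θ : 𝓢(V, ℝ) := θ.hasCompactSupport.toSchwartzMap hθc
  refine ⟨SchwartzMap.seminorm ℝ 0 i Θ + 1, by positivity, fun y => ?_⟩
  by_cases hy : ‖y‖ < 1
  · have h0 : (fun y => θ y - 1) =ᶠ[nhds y] fun _ => 0 := by
      have : Metric.ball (0 : V) 1 ∈ nhds y := Metric.isOpen_ball.mem_nhds (by simpa using hy)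
      filter_upwards [this] with z hz
      rw [θ.one_of_mem_closedBall, sub_self]
      simp only [Metric.mem_ball, dist_zero_right, Metric.mem_closedBall] at hz ⊢
      linarith
    rw [(Filter.EventuallyEq.iteratedFDeriv ℝ h0 i).eq_of_nhds]
    simp only [iteratedFDeriv_fun_zero, Pi.zero_apply, norm_zero]
    positivity
  · have h1 : ‖iteratedFDeriv ℝ i (fun y => θ y - 1) y‖ ≤ SchwartzMap.seminorm ℝ 0 i Θ + 1 := by
      have h2 : (fun y => θ y - 1) = (θ : V → ℝ) - fun _ => 1 := rfl
      rw [h2, iteratedFDeriv_sub (hθc.of_le (by exact_mod_cast le_top)) contDiff_const,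
        Pi.sub_apply]
      refine (norm_sub_le _ _).trans (add_le_add ?_ ?_)
      · exact SchwartzMap.norm_iteratedFDeriv_le_seminorm ℝ Θ i y
      · rcases i with _ | i
        · simp
        · simp [iteratedFDeriv_succ_const]
    refine h1.trans (le_mul_of_one_le_right (by positivity) (not_lt.1 hy))

/-- Every Schwartz function is the limit of compactly supported ones, which it dominates. -/
lemma exists_tendsto_schwartz_hasCompactSupport (χ : 𝓢(V, ℂ)) :
    ∃ χs : ℕ → 𝓢(V, ℂ), (∀ n, HasCompactSupport (χs n : V → ℂ)) ∧
      (∀ n x, ‖χs n x‖ ≤ ‖χ x‖) ∧ Filter.Tendsto χs Filter.atTop (nhds χ) := by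
  obtain ⟨θ, hθ⟩ : ∃ θ : ContDiffBump (0 : V), 1 ≤ θ.rIn := ⟨⟨1, 2, one_pos, one_lt_two⟩, le_rfl⟩
  have hc : ∀ n : ℕ, ContDiff ℝ ((⊤ : ℕ∞) : WithTop ℕ∞)
      (fun x : V => θ (((n : ℝ) + 1)⁻¹ • x)) := fun n =>
    θ.contDiff.comp (contDiff_const_smul _)
  have hcs : ∀ n : ℕ, HasCompactSupport (fun x : V => θ (((n : ℝ) + 1)⁻¹ • x) • χ x) := by
    intro n
    have hn : ((n : ℝ) + 1)⁻¹ ≠ 0 := by positivity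
    refine (θ.hasCompactSupport.comp_smul hn).mono fun x hx hθx => hx ?_
    dsimp only at hθx ⊢
    rw [hθx, zero_smul]
  set χs : ℕ → 𝓢(V, ℂ) := fun n => (hcs n).toSchwartzMap ((hc n).smul (χ.smooth ⊤))
  have hχs : ∀ n x, χs n x = θ (((n : ℝ) + 1)⁻¹ • x) • χ x := fun n x => rfl
  refine ⟨χs, hcs, fun n x => ?_, ?_⟩
  · rw [hχs, norm_smul, Real.norm_of_nonneg θ.nonneg]
    exact mul_le_of_le_one_left (norm_nonneg _) θ.le_one
  rw [(schwartz_withSeminorms ℝ V ℂ).tendsto_nhds]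
  rintro ⟨k, m⟩ ε hε
  choose C hC0 hC using exists_norm_iteratedFDeriv_sub_one_le θ hθ
  -- The Leibniz sum; the index `k + 1` in place of `k` absorbs the extra power of `‖x‖`.
  set K : ℝ := ∑ i ∈ Finset.range (m + 1),
    (m.choose i : ℝ) * C i * SchwartzMap.seminorm ℝ (k + 1) (m - i) χ
  have hK0 : 0 ≤ K := Finset.sum_nonneg fun i _ => by have := hC0 i; positivity
  have hlim : Filter.Tendsto (fun n : ℕ => K * (1 / ((n : ℝ) + 1))) Filter.atTop (nhds (K * 0)) :=
    tendsto_one_div_add_atTop_nhds_zero_nat.const_mul K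
  rw [mul_zero] at hlim
  filter_upwards [hlim.eventually (gt_mem_nhds hε)] with n hn
  refine lt_of_le_of_lt ?_ hn
  refine SchwartzMap.seminorm_le_bound ℝ k m _ (by positivity) fun x => ?_
  set φ : V → ℝ := fun x => θ (((n : ℝ) + 1)⁻¹ • x) - 1
  have hφ : ContDiff ℝ ((⊤ : ℕ∞) : WithTop ℕ∞) φ := (hc n).sub contDiff_const
  have e1 : (⇑(χs n - χ) : V → ℂ) = fun x => φ x • χ x := by
    funext x
    simp [hχs, φ, sub_mul]
  have e2 : ∀ i : ℕ, ‖iteratedFDeriv ℝ i φ x‖ ≤ C i * ‖x‖ * (1 / ((n : ℝ) + 1)) := by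
    intro i
    have hs : ContDiff ℝ i (fun y => θ y - 1) :=
      (θ.contDiff (n := ⊤)).sub contDiff_const |>.of_le (by exact_mod_cast le_top)
    have := congrFun (iteratedFDeriv_comp_const_smul (((n : ℝ) + 1)⁻¹) hs) x
    change iteratedFDeriv ℝ i φ x = _ at this
    -- The powers of `1 / (n + 1)` from the chain rule are only bounded by `1`, since for `i = 0`
    -- there are none; the decay comes from `hC`.
    have hn1 : ((n : ℝ) + 1)⁻¹ ≤ 1 := inv_le_one_of_one_le₀ (by linarith [n.cast_nonneg (α := ℝ)])
    have hn0 : 0 ≤ ((n : ℝ) + 1)⁻¹ := by positivity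
    rw [this, norm_smul, norm_pow, Real.norm_of_nonneg hn0]
    calc _ ≤ 1 * (C i * ‖((n : ℝ) + 1)⁻¹ • x‖) :=
          mul_le_mul (pow_le_one₀ hn0 hn1) (hC i _) (norm_nonneg _) zero_le_one
      _ = _ := by rw [norm_smul, Real.norm_of_nonneg hn0]; ring
  rw [e1]
  have h3 := norm_iteratedFDeriv_smul_le hφ (χ.smooth ⊤) x (n := m) (by exact_mod_cast le_top)
  calc ‖x‖ ^ k * ‖iteratedFDeriv ℝ m (fun x => φ x • χ x) x‖
      ≤ ‖x‖ ^ k * ∑ i ∈ Finset.range (m + 1), (m.choose i : ℝ) * ‖iteratedFDeriv ℝ i φ x‖ *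
          ‖iteratedFDeriv ℝ (m - i) χ x‖ := by gcongr
    _ ≤ ‖x‖ ^ k * ∑ i ∈ Finset.range (m + 1), (m.choose i : ℝ) *
          (C i * ‖x‖ * (1 / ((n : ℝ) + 1))) * ‖iteratedFDeriv ℝ (m - i) χ x‖ := by
        gcongr with i
        exact e2 i
    _ = ∑ i ∈ Finset.range (m + 1), (m.choose i : ℝ) * C i *
          (‖x‖ ^ (k + 1) * ‖iteratedFDeriv ℝ (m - i) χ x‖) * (1 / ((n : ℝ) + 1)) := by
        rw [Finset.mul_sum]
        refine Finset.sum_congr rfl fun i _ => by ring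
    _ ≤ K * (1 / ((n : ℝ) + 1)) := by
        rw [Finset.sum_mul]
        gcongr with i
        · have := hC0 i; positivity
        · exact SchwartzMap.le_seminorm ℝ _ _ χ x

end Cutoff

/-! ### Uniqueness of representing functions and of free solutions. -/

/-- The compactly supported approximants are dominated by `χ`, so dominated convergence extends the
representation from compactly supported tests to every `χ` with `χ f` integrable. -/
lemma IsGivenBy.apply_eq {T : 𝓢'(Space3, ℂ)} {f : Space3 → ℂ} (h : IsGivenBy T f)
    (χ : 𝓢(Space3, ℂ)) (hχ : Integrable fun x => χ x * f x) : T χ = ∫ x, χ x * f x := by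
  obtain ⟨χs, h1, h2, h3⟩ := exists_tendsto_schwartz_hasCompactSupport χ
  have h4 : Filter.Tendsto (fun n => T (χs n)) Filter.atTop (nhds (T χ)) :=
    (T.continuous.tendsto χ).comp h3
  have h5 : Filter.Tendsto (fun n => ∫ x, χs n x * f x) Filter.atTop
      (nhds (∫ x, χ x * f x)) := by
    refine tendsto_integral_of_dominated_convergence (fun x => ‖χ x * f x‖)
      (fun n => (χs n).continuous.aestronglyMeasurable.mul h.1.aestronglyMeasurable) hχ.norm
      (fun n => .of_forall fun x => ?_) (.of_forall fun x => ?_)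
    · rw [norm_mul, norm_mul]
      exact mul_le_mul_of_nonneg_right (h2 n x) (norm_nonneg _)
    · refine Filter.Tendsto.mul_const _ ?_
      exact ((TemperedDistribution.delta x).continuous.tendsto χ).comp h3
  have h6 : ∀ n, T (χs n) = ∫ x, χs n x * f x := fun n => h.2 _ (h1 n)
  simp only [h6] at h4
  exact tendsto_nhds_unique h4 h5

lemma IsGivenBy.ae_eq {T : 𝓢'(Space3, ℂ)} {f f' : Space3 → ℂ} (h : IsGivenBy T f)
    (h' : IsGivenBy T f') : f =ᵐ[volume] f' :=
  ae_eq_of_integral_schwartz_mul_eq h.1 h'.1 fun ψ hψ => (h.2 ψ hψ).symm.trans (h'.2 ψ hψ)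

/-- Free solutions with the same initial datum agree almost everywhere on space-time. -/
lemma IsFreeSolution.ae_eq {u u' : ℝ × Space3 → ℂ} {u₀ : 𝓢'(Space3, ℂ)}
    (h : IsFreeSolution u u₀) (h' : IsFreeSolution u' u₀) : u =ᵐ[volume] u' := by
  obtain ⟨⟨v, hv, hm⟩, h⟩ := h
  obtain ⟨⟨v', hv', hm'⟩, h'⟩ := h'
  have key : v =ᵐ[volume] v' := by
    have hms : MeasurableSet {p | v p ≠ v' p} :=
      (measurableSet_eq_fun hv.measurable hv'.measurable).compl
    rw [Filter.EventuallyEq, ae_iff, Measure.volume_eq_prod]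
    refine (Measure.measure_prod_null hms).2 ?_
    rw [Measure.volume_eq_prod] at hm hm'
    filter_upwards [h, h', Measure.ae_ae_of_ae_prod hm, Measure.ae_ae_of_ae_prod hm'] with
      t h1 h2 h3 h4
    have : ∀ᵐ z : Space3, v (t, z) = v' (t, z) := by
      filter_upwards [h1.ae_eq h2, h3, h4] with z e1 e2 e3
      rw [← e2, ← e3, e1]
    exact ae_iff.1 this
  exact hm.trans (key.trans hm'.symm)

/-! ### The evolution in terms of the Fourier transform -/

lemma zkSymbol_eq (t : ℝ) (ζ : Space3) : zkSymbol t ζ = (Real.fourierChar (t * zkFreq ζ) : ℂ) := by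
  rw [zkSymbol, Real.fourierChar_apply]
  congr 1
  simp only [zkPhase, zkFreq, PiLp.smul_apply, smul_eq_mul]
  push_cast
  ring

/-- The multiplication formula for the inverse transform, whose kernel is that of `-innerₗ`. The
right side is the one in `zkFlow_apply_eq`, which matches waves with the flow on distributions. -/
lemma integral_schwartz_mul_freeWave (t : ℝ) {f : Space3 → ℂ} (hf : Integrable f)
    (ψ : 𝓢(Space3, ℂ)) :
    ∫ z, ψ z * freeWave f (t, z) = ∫ ζ, zkSymbol t ζ * (𝓕⁻ ψ) ζ * f ζ := by
  have hi : Integrable fun ζ : Space3 => Real.fourierChar (t * zkFreq ζ) • f ζ :=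
    integrable_fourierChar_smul (continuous_zkFreq.measurable.const_mul t) hf
  have h1 := VectorFourier.integral_fourierIntegral_smul_eq_flip (L := -innerₗ Space3)
    (μ := volume) (ν := volume)
    Real.continuous_fourierChar (continuous_inner.neg) ψ.integrable hi
  have h2 : (-innerₗ Space3).flip = -innerₗ Space3 := by
    ext x y
    simp [real_inner_comm]
  rw [h2] at h1
  have h3 : ∀ z : Space3, freeWave f (t, z) = VectorFourier.fourierIntegral Real.fourierChar volume
      (-innerₗ Space3) (fun ζ : Space3 => Real.fourierChar (t * zkFreq ζ) • f ζ) z := by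
    intro z
    refine integral_congr_ae (.of_forall fun ζ => ?_)
    simp only [AddChar.map_add_eq_mul, mul_smul, LinearMap.neg_apply, neg_neg, innerₗ_apply_apply]
    rw [smul_comm, real_inner_comm]
  simp only [h3]
  simp only [smul_eq_mul] at h1
  rw [← h1]
  refine integral_congr_ae (.of_forall fun ζ => ?_)
  have h4 : (𝓕⁻ ψ) ζ = VectorFourier.fourierIntegral Real.fourierChar volume
      (-innerₗ Space3) (ψ : Space3 → ℂ) ζ := by
    rw [SchwartzMap.fourierInv_coe]
    rfl
  simp only [h4, zkSymbol_eq, Circle.smul_def, smul_eq_mul]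
  ring

lemma zkFlow_apply_eq (t : ℝ) {u₀ : 𝓢'(Space3, ℂ)} {f : Space3 → ℂ}
    (hu : ∀ χ : 𝓢(Space3, ℂ), (𝓕 u₀) χ = ∫ ζ, χ ζ * f ζ) (ψ : 𝓢(Space3, ℂ)) :
    zkFlow t u₀ ψ = ∫ ζ, zkSymbol t ζ * (𝓕⁻ ψ) ζ * f ζ := by
  rw [zkFlow, TemperedDistribution.fourierMultiplierCLM_apply_apply,
    ← TemperedDistribution.fourier_apply, hu]
  simp only [SchwartzMap.smulLeftCLM_apply_apply (hasTemperateGrowth_zkSymbol t), smul_eq_mul]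

/-! ### Local bounds -/

/-- Local integrability on space-time of free solutions, in terms of a weighted `L²` norm. -/
def LocallyControls (α : ℝ → ℝ≥0∞) : Prop :=
  ∀ K : Set (ℝ × Space3), IsCompact K → ∃ C : ℝ≥0∞, C ≠ ∞ ∧ ∀ f : Space3 → ℂ, Integrable f →
    (∫⁻ p in K, ‖freeWave f p‖ₑ) ^ 2 ≤ C * weightedSq α f

/-- The datum `g` cancels all phases at `p₀`, so its wave there equals the volume of the unit ball.
By continuity it exceeds some `c > 0` in modulus near `p₀`, and dividing the bilinear estimate by
`c²` leaves a bound for the other factor alone. -/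
lemma exists_isOpen_lintegral_freeWave_sq_le {α β : ℝ → ℝ≥0∞} {A : ℝ≥0∞} (hA : A ≠ ∞)
    (h : AdmissibleWeights α β A)
    (hβ : weightedSq β ((Metric.ball 0 1).indicator fun _ => 1) ≠ ∞) (p₀ : ℝ × Space3) :
    ∃ U : Set (ℝ × Space3), IsOpen U ∧ p₀ ∈ U ∧ ∃ C : ℝ≥0∞, C ≠ ∞ ∧
      ∀ f : Space3 → ℂ, Integrable f → ∫⁻ p in U, ‖freeWave f p‖ₑ ^ 2 ≤ C * weightedSq α f := by
  set θ : Space3 → ℝ := fun ζ => p₀.1 * zkFreq ζ + inner ℝ p₀.2 ζ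
  have hθ : Measurable θ := measurable_freePhase p₀
  set ρ : Space3 → ℂ := (Metric.ball 0 1).indicator fun _ => 1
  have hρ : Integrable ρ :=
    (integrable_indicator_iff Metric.isOpen_ball.measurableSet).2
      (integrableOn_const (by exact measure_ball_lt_top.ne))
  set g : Space3 → ℂ := fun ζ => Real.fourierChar (-θ ζ) • ρ ζ
  have hg : Integrable g := integrable_fourierChar_smul hθ.neg hρ
  have hgβ : weightedSq β g = weightedSq β ρ := by
    refine lintegral_congr fun ζ => ?_
    have : ‖g ζ‖ₑ = ‖ρ ζ‖ₑ := by
      rw [enorm_eq_iff_norm_eq]; exact Circle.norm_smul _ _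
    rw [this]
  have hv0 : freeWave g p₀ = ((volume (Metric.ball (0 : Space3) 1)).toReal : ℂ) := by
    have : ∀ ζ, Real.fourierChar (p₀.1 * zkFreq ζ + inner ℝ p₀.2 ζ) • g ζ = ρ ζ := by
      intro ζ
      change Real.fourierChar (θ ζ) • Real.fourierChar (-θ ζ) • ρ ζ = ρ ζ
      rw [smul_smul, ← AddChar.map_add_eq_mul, add_neg_cancel, AddChar.map_zero_eq_one, one_smul]
    simp only [freeWave, this, ρ]
    rw [integral_indicator Metric.isOpen_ball.measurableSet]
    simp [Measure.real]
  have hpos : 0 < ‖freeWave g p₀‖ := by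
    rw [norm_pos_iff, hv0]
    exact_mod_cast (ENNReal.toReal_pos
      (Metric.measure_ball_pos volume (0 : Space3) one_pos).ne' measure_ball_lt_top.ne).ne'
  set c : ℝ := ‖freeWave g p₀‖ / 2 with hc
  have hc0 : 0 < c := by positivity
  have hU : IsOpen {p | c < ‖freeWave g p‖} :=
    isOpen_lt continuous_const (continuous_freeWave hg).norm
  refine ⟨{p | c < ‖freeWave g p‖}, hU, by simp only [Set.mem_ofPred_eq, hc]; linarith,
    ((ENNReal.ofReal c)⁻¹) ^ 2 * (16 * A * weightedSq β g), ?_, fun f hf => ?_⟩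
  · refine ENNReal.mul_ne_top (ENNReal.pow_ne_top (by simpa using hc0)) ?_
    refine ENNReal.mul_ne_top (ENNReal.mul_ne_top (by norm_num) hA) ?_
    rwa [hgβ]
  · have hc1 : ENNReal.ofReal c ≠ 0 := by simpa using hc0
    calc ∫⁻ p in {p | c < ‖freeWave g p‖}, ‖freeWave f p‖ₑ ^ 2
        ≤ ∫⁻ p in {p | c < ‖freeWave g p‖},
            ((ENNReal.ofReal c)⁻¹) ^ 2 * ‖freeWave f p * freeWave g p‖ₑ ^ 2 := by
          refine setLIntegral_mono' hU.measurableSet fun p hp => ?_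
          rw [← mul_pow]
          refine pow_le_pow_left' ?_ 2
          have : ENNReal.ofReal c ≤ ‖freeWave g p‖ₑ := by
            rw [← ofReal_norm]
            exact ENNReal.ofReal_le_ofReal (le_of_lt hp)
          rw [enorm_mul]
          calc ‖freeWave f p‖ₑ = (ENNReal.ofReal c)⁻¹ * (‖freeWave f p‖ₑ * ENNReal.ofReal c) := by
                rw [mul_left_comm, ENNReal.inv_mul_cancel hc1 ENNReal.ofReal_ne_top, mul_one]
            _ ≤ _ := by gcongr
      _ ≤ ∫⁻ p, ((ENNReal.ofReal c)⁻¹) ^ 2 * ‖freeWave f p * freeWave g p‖ₑ ^ 2 :=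
          setLIntegral_le_lintegral _ _
      _ ≤ ((ENNReal.ofReal c)⁻¹) ^ 2 * (16 * A * (weightedSq α f * weightedSq β g)) := by
          rw [lintegral_const_mul' _ _ (ENNReal.pow_ne_top (by simpa using hc0))]
          gcongr
          exact lintegral_freeWave_mul_sq_le h hf hg
      _ = _ := by ring

/-- A finite cover of `K` yields a bound in `L²(K)`; Cauchy–Schwarz against `1` turns it into one in
`L¹(K)`. -/
lemma locallyControls_of_admissibleWeights {α β : ℝ → ℝ≥0∞} {A : ℝ≥0∞} (hA : A ≠ ∞)
    (h : AdmissibleWeights α β A)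
    (hβ : weightedSq β ((Metric.ball 0 1).indicator fun _ => 1) ≠ ∞) : LocallyControls α := by
  intro K hK
  have h1 : ∃ C : ℝ≥0∞, C ≠ ∞ ∧ ∀ f : Space3 → ℂ, Integrable f →
      ∫⁻ p in K, ‖freeWave f p‖ₑ ^ 2 ≤ C * weightedSq α f := by
    refine hK.induction_on (p := fun s => ∃ C : ℝ≥0∞, C ≠ ∞ ∧ ∀ f : Space3 → ℂ, Integrable f →
      ∫⁻ p in s, ‖freeWave f p‖ₑ ^ 2 ≤ C * weightedSq α f) ?_ ?_ ?_ ?_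
    · exact ⟨0, by simp, by simp⟩
    · rintro s t hst ⟨C, hC, hb⟩
      exact ⟨C, hC, fun f hf => (lintegral_mono_set hst).trans (hb f hf)⟩
    · rintro s t ⟨C, hC, hb⟩ ⟨C', hC', hb'⟩
      refine ⟨C + C', ENNReal.add_ne_top.2 ⟨hC, hC'⟩, fun f hf => ?_⟩
      rw [add_mul]
      exact (lintegral_union_le _ _ _).trans (add_le_add (hb f hf) (hb' f hf))
    · intro p _
      obtain ⟨U, hU, hpU, hC⟩ := exists_isOpen_lintegral_freeWave_sq_le hA h hβ p
      exact ⟨U, mem_nhdsWithin_of_mem_nhds (hU.mem_nhds hpU), hC⟩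
  obtain ⟨C, hC, hb⟩ := h1
  refine ⟨volume K * C, ENNReal.mul_ne_top hK.measure_lt_top.ne hC, fun f hf => ?_⟩
  have h2 := sq_lintegral_mul_le (μ := volume.restrict K) (f := fun _ => 1)
    (g := fun p => ‖freeWave f p‖ₑ) aemeasurable_const
    (continuous_freeWave hf).measurable.enorm.aemeasurable
  simp only [one_mul, one_pow, lintegral_const, Measure.restrict_apply MeasurableSet.univ,
    Set.univ_inter] at h2
  rw [mul_assoc]
  exact h2.trans (mul_le_mul' le_rfl (hb f hf))

/-! ### Construction of free solutions -/

lemma tendsto_weightedSq_indicator_compl_ball {α : ℝ → ℝ≥0∞} (hα : Measurable α) {f : Space3 → ℂ}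
    (hf : AEStronglyMeasurable f volume) (hfα : weightedSq α f ≠ ∞) :
    Filter.Tendsto (fun n : ℕ => weightedSq α ((Metric.ball 0 (n : ℝ))ᶜ.indicator f)) Filter.atTop
      (nhds 0) := by
  have hz : (0 : ℝ≥0∞) = ∫⁻ _ : Space3, 0 := by simp
  rw [hz]
  refine tendsto_lintegral_of_dominated_convergence' (fun ζ => (α (ζ 0) * ‖f ζ‖ₑ) ^ 2)
    (fun n => ?_) (fun n => .of_forall fun ζ => ?_) hfα (.of_forall fun ζ => ?_)
  · exact ((by fun_prop : Measurable fun ζ : Space3 => α (ζ 0)).aemeasurable.mul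
      (hf.indicator Metric.isOpen_ball.measurableSet.compl).enorm).pow_const 2
  · exact pow_le_pow_left' (mul_le_mul' le_rfl (enorm_indicator_le _ _)) 2
  · refine tendsto_const_nhds.congr' ?_
    obtain ⟨N, hN⟩ := exists_nat_gt ‖ζ‖
    filter_upwards [Filter.eventually_ge_atTop N] with n hn
    have : ζ ∈ Metric.ball (0 : Space3) (n : ℝ) := by
      rw [mem_ball_zero_iff]
      exact hN.trans_le (by exact_mod_cast hn)
    simp [this]

/-- The truncation of the Fourier data to a ball. -/
noncomputable def truncate (f : Space3 → ℂ) (n : ℕ) : Space3 → ℂ :=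
  (Metric.ball 0 (n : ℝ)).indicator f

lemma integrable_truncate {f : Space3 → ℂ} (hf : LocallyIntegrable f) (n : ℕ) :
    Integrable (truncate f n) :=
  ((hf.integrableOn_isCompact (isCompact_closedBall 0 (n : ℝ))).mono_set
    Metric.ball_subset_closedBall).integrable_indicator Metric.isOpen_ball.measurableSet

lemma weightedSq_truncate_sub_le (α : ℝ → ℝ≥0∞) (f : Space3 → ℂ) {m n : ℕ} (h : m ≤ n) :
    weightedSq α (fun ζ => truncate f n ζ - truncate f m ζ) ≤
      weightedSq α ((Metric.ball 0 (m : ℝ))ᶜ.indicator f) := by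
  refine weightedSq_mono α fun ζ => ?_
  have hmn : Metric.ball (0 : Space3) (m : ℝ) ⊆ Metric.ball 0 (n : ℝ) :=
    Metric.ball_subset_ball (by exact_mod_cast h)
  by_cases h1 : ζ ∈ Metric.ball (0 : Space3) (m : ℝ)
  · simp [truncate, h1, hmn h1]
  · by_cases h2 : ζ ∈ Metric.ball (0 : Space3) (n : ℝ) <;> simp [truncate, h1, h2]

lemma tendsto_truncate (f : Space3 → ℂ) {r : ℕ → ℕ} (hr : StrictMono r) (ζ : Space3) :
    Filter.Tendsto (fun n => truncate f (r n) ζ) Filter.atTop (nhds (f ζ)) := by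
  refine tendsto_const_nhds.congr' ?_
  obtain ⟨N, hN⟩ := exists_nat_gt ‖ζ‖
  filter_upwards [Filter.eventually_ge_atTop N] with n hn
  have : ζ ∈ Metric.ball (0 : Space3) (r n : ℝ) := by
    rw [mem_ball_zero_iff]
    exact hN.trans_le (by exact_mod_cast hn.trans (hr.id_le n))
  simp [truncate, this]

/-- The truncations converge almost everywhere along a subsequence, with a locally integrable
majorant. -/
lemma exists_tendsto_freeWave_truncate {α : ℝ → ℝ≥0∞} (hα : Measurable α)
    (hαc : LocallyControls α) {f : Space3 → ℂ} (hf : LocallyIntegrable f)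
    (hfα : weightedSq α f ≠ ∞) :
    ∃ (r : ℕ → ℕ) (u : ℝ × Space3 → ℂ) (S : ℝ × Space3 → ℝ≥0∞), StrictMono r ∧
      StronglyMeasurable u ∧ Measurable S ∧
      (∀ K, IsCompact K → ∫⁻ p in K, S p ≠ ∞) ∧
      (∀ n p, ‖freeWave (truncate f (r n)) p‖ₑ ≤ S p) ∧
      ∀ᵐ p, Filter.Tendsto (fun n => freeWave (truncate f (r n)) p) Filter.atTop (nhds (u p)) := by
  -- The tails are made smaller than `4⁻ⁿ`, so that the `L¹(K)` norms of consecutive differences are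
  -- summable and the telescoping majorant `S` is locally integrable.
  have hev : ∀ n : ℕ, ∀ᶠ k : ℕ in Filter.atTop,
      weightedSq α ((Metric.ball 0 (k : ℝ))ᶜ.indicator f) < ((2⁻¹ : ℝ≥0∞) ^ n) ^ 2 := fun n =>
    (tendsto_weightedSq_indicator_compl_ball hα hf.aestronglyMeasurable hfα).eventually
      (gt_mem_nhds (by simp [pos_iff_ne_zero]))
  obtain ⟨r, hr, hrb⟩ := Filter.extraction_forall_of_eventually hev
  set w : ℕ → ℝ × Space3 → ℂ := fun n => freeWave (truncate f (r n)) with hw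
  have hwi : ∀ n, Integrable (truncate f (r n)) := fun n => integrable_truncate hf _
  have hwm : ∀ n, Measurable (w n) := fun n => (continuous_freeWave (hwi n)).measurable
  set S : ℝ × Space3 → ℝ≥0∞ := fun p => ‖w 0 p‖ₑ + ∑' n, ‖w (n + 1) p - w n p‖ₑ with hS
  have hSm : Measurable S := by
    refine (hwm 0).enorm.add (Measurable.tsum fun n => ?_)
    exact ((hwm (n + 1)).sub (hwm n)).enorm
  have hSK : ∀ K, IsCompact K → ∫⁻ p in K, S p ≠ ∞ := by
    intro K hK
    obtain ⟨C, hC, hb⟩ := hαc K hK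
    have hdm : ∀ n, AEMeasurable (fun p => ‖w (n + 1) p - w n p‖ₑ) (volume.restrict K) := fun n =>
      ((hwm (n + 1)).sub (hwm n)).enorm.aemeasurable
    rw [lintegral_add_left (hwm 0).enorm, lintegral_tsum hdm]
    refine ENNReal.add_ne_top.2 ⟨?_, ?_⟩
    · exact ((continuous_freeWave (hwi 0)).continuousOn.integrableOn_compact hK).2.ne
    · have hterm : ∀ n, ∫⁻ p in K, ‖w (n + 1) p - w n p‖ₑ ≤ (C + 1) * 2⁻¹ ^ n := by
        intro n
        have h1 := hb _ ((hwi (n + 1)).sub (hwi n))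
        have h2 := (weightedSq_truncate_sub_le α f (hr.monotone n.le_succ)).trans (hrb n).le
        have h3 : ∀ p, w (n + 1) p - w n p =
            freeWave (truncate f (r (n + 1)) - truncate f (r n)) p := fun p =>
          (freeWave_sub (hwi (n + 1)) (hwi n) p).symm
        simp only [h3]
        refine (ENNReal.pow_right_strictMono two_ne_zero).le_iff_le.1 (h1.trans ?_)
        rw [mul_pow]
        refine mul_le_mul' ?_ h2
        -- `C ≤ (C + 1)²` avoids taking a square root of `C`.
        calc C ≤ (C + 1) * 1 := by rw [mul_one]; exact le_self_add
          _ ≤ (C + 1) * (C + 1) := by gcongr; exact le_add_self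
          _ = _ := (sq _).symm
      refine ne_top_of_le_ne_top ?_ (ENNReal.tsum_le_tsum hterm)
      rw [ENNReal.tsum_mul_left, ENNReal.tsum_geometric]
      refine ENNReal.mul_ne_top (ENNReal.add_ne_top.2 ⟨hC, ENNReal.one_ne_top⟩) ?_
      simp
  have hwS : ∀ n p, ‖w n p‖ₑ ≤ S p := by
    intro n p
    have h1 : ∀ n, ‖w n p‖ₑ ≤ ‖w 0 p‖ₑ + ∑ i ∈ Finset.range n, ‖w (i + 1) p - w i p‖ₑ := by
      intro n
      induction n with
      | zero => simp
      | succ n ih =>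
        rw [Finset.sum_range_succ, ← add_assoc]
        calc ‖w (n + 1) p‖ₑ = ‖w n p + (w (n + 1) p - w n p)‖ₑ := by rw [add_sub_cancel]
          _ ≤ _ := (enorm_add_le _ _).trans (add_le_add ih le_rfl)
    exact (h1 n).trans (add_le_add le_rfl (ENNReal.sum_le_tsum _))
  have hae : ∀ᵐ p, S p < ∞ := by
    have h1 : ∀ n : ℕ, ∀ᵐ p, p ∈ Metric.closedBall (0 : ℝ × Space3) (n : ℝ) → S p < ∞ := by
      intro n
      rw [← ae_restrict_iff' Metric.isClosed_closedBall.measurableSet]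
      exact ae_lt_top hSm (hSK _ (isCompact_closedBall _ _))
    filter_upwards [ae_all_iff.2 h1] with p hp
    obtain ⟨n, hn⟩ := exists_nat_ge ‖p‖
    exact hp n (by simpa using hn)
  have hlim : ∀ᵐ p, ∃ l, Filter.Tendsto (fun n => w n p) Filter.atTop (nhds l) := by
    filter_upwards [hae] with p hp
    refine cauchySeq_tendsto_of_complete (cauchySeq_of_edist_le_of_tsum_ne_top
      (fun n => ‖w (n + 1) p - w n p‖ₑ) (fun n => ?_) ?_)
    · rw [edist_comm, edist_eq_enorm_sub]
    · exact (ENNReal.add_ne_top.1 hp.ne).2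
  obtain ⟨u, hu, hul⟩ := exists_stronglyMeasurable_limit_of_tendsto_ae
    (fun n => (hwm n).aestronglyMeasurable) hlim
  exact ⟨r, u, S, hr, hu, hSm, hSK, hwS, hul⟩

/-- The pairing with `ψ` is passed to the limit twice: in physical space with majorant `|ψ| S(t,
·)`, integrable for almost every `t` by Tonelli, and in frequency with majorant `|𝓕⁻ψ · f|`.
Uniqueness of limits identifies `u(t, ·)` with the flow. -/
lemma isFreeSolution_of_tendsto {f : Space3 → ℂ} (hf : LocallyIntegrable f) {r : ℕ → ℕ}
    (hr : StrictMono r) {u : ℝ × Space3 → ℂ} {S : ℝ × Space3 → ℝ≥0∞} (hu : StronglyMeasurable u)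
    (hS : Measurable S) (hSK : ∀ K, IsCompact K → ∫⁻ p in K, S p ≠ ∞)
    (hSb : ∀ n p, ‖freeWave (truncate f (r n)) p‖ₑ ≤ S p)
    (hlim : ∀ᵐ p, Filter.Tendsto (fun n => freeWave (truncate f (r n)) p) Filter.atTop
      (nhds (u p)))
    {u₀ : 𝓢'(Space3, ℂ)} (hχ : ∀ χ : 𝓢(Space3, ℂ), Integrable fun ζ => χ ζ * f ζ)
    (hu₀ : ∀ χ : 𝓢(Space3, ℂ), (𝓕 u₀) χ = ∫ ζ, χ ζ * f ζ) : IsFreeSolution u u₀ := by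
  have hSt : ∀ᵐ t : ℝ, ∀ n : ℕ, ∫⁻ z in Metric.closedBall (0 : Space3) (n : ℝ), S (t, z) ≠ ∞ := by
    have h1 : ∀ m n : ℕ, ∀ᵐ t : ℝ, t ∈ Metric.closedBall (0 : ℝ) (m : ℝ) →
        ∫⁻ z in Metric.closedBall (0 : Space3) (n : ℝ), S (t, z) < ∞ := by
      intro m n
      rw [← ae_restrict_iff' Metric.isClosed_closedBall.measurableSet]
      refine ae_lt_top (Measurable.lintegral_prod_right hS) ?_
      rw [← lintegral_prod _ hS.aemeasurable, Measure.prod_restrict, ← Measure.volume_eq_prod]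
      exact hSK _ ((isCompact_closedBall _ _).prod (isCompact_closedBall _ _))
    filter_upwards [ae_all_iff.2 fun m => ae_all_iff.2 (h1 m)] with t ht n
    obtain ⟨m, hm⟩ := exists_nat_ge ‖t‖
    exact (ht m n (by simpa using hm)).ne
  rw [Measure.volume_eq_prod] at hlim
  refine ⟨hu.aestronglyMeasurable, ?_⟩
  filter_upwards [hSt, Measure.ae_ae_of_ae_prod hlim] with t h1 h2
  have hut : AEStronglyMeasurable (fun z => u (t, z)) volume :=
    (hu.comp_measurable (measurable_prodMk_left (x := t))).aestronglyMeasurable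
  have hStm : Measurable fun z => S (t, z) := hS.comp measurable_prodMk_left
  have huS : ∀ᵐ z, ‖u (t, z)‖ₑ ≤ S (t, z) := by
    filter_upwards [h2] with z hz
    exact le_of_tendsto hz.enorm (.of_forall fun n => hSb n _)
  refine ⟨?_, fun ψ hψ => ?_⟩
  · rw [locallyIntegrable_iff]
    intro K hK
    obtain ⟨n, hn⟩ := hK.isBounded.subset_closedBall_lt 0 0
    obtain ⟨m, hm⟩ := exists_nat_ge n
    refine ⟨hut.restrict, lt_of_le_of_lt (lintegral_mono_ae (ae_restrict_of_ae huS)) ?_⟩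
    exact lt_of_le_of_lt (lintegral_mono_set (hn.2.trans (Metric.closedBall_subset_closedBall hm)))
      (h1 m).lt_top
  · have hψS : ∫⁻ z, ‖ψ z‖ₑ * S (t, z) ≠ ∞ := by
      obtain ⟨n, hn⟩ := hψ.isCompact.isBounded.subset_closedBall_lt 0 0
      obtain ⟨m, hm⟩ := exists_nat_ge n
      obtain ⟨C, hC⟩ := ψ.continuous.bounded_above_of_compact_support hψ
      have h3 : ∀ z, ‖ψ z‖ₑ * S (t, z) ≤ (Metric.closedBall (0 : Space3) (m : ℝ)).indicator
          (fun z => ENNReal.ofReal C * S (t, z)) z := by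
        intro z
        by_cases hz : z ∈ Metric.closedBall (0 : Space3) (m : ℝ)
        · rw [Set.indicator_of_mem hz, ← ofReal_norm]
          gcongr
          exact hC z
        · have : ψ z = 0 := by
            by_contra hne
            exact hz (Metric.closedBall_subset_closedBall hm (hn.2 (subset_tsupport _ hne)))
          simp [this]
      refine ne_top_of_le_ne_top ?_ (lintegral_mono h3)
      rw [lintegral_indicator Metric.isClosed_closedBall.measurableSet,
        lintegral_const_mul _ hStm]
      exact ENNReal.mul_ne_top ENNReal.ofReal_ne_top (h1 m)
    have hfin : ∀ᵐ z, ‖ψ z‖ₑ * S (t, z) < ∞ :=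
      ae_lt_top (ψ.continuous.measurable.enorm.mul hStm) hψS
    have hconv : Filter.Tendsto (fun n => ∫ z, ψ z * freeWave (truncate f (r n)) (t, z))
        Filter.atTop (nhds (∫ z, ψ z * u (t, z))) := by
      refine tendsto_integral_of_dominated_convergence (fun z => (‖ψ z‖ₑ * S (t, z)).toReal)
        (fun n => ?_) (integrable_toReal_of_lintegral_ne_top
          (ψ.continuous.measurable.enorm.mul hStm).aemeasurable hψS) (fun n => ?_) ?_
      · exact (ψ.continuous.mul ((continuous_freeWave (integrable_truncate hf _)).comp
          (Continuous.prodMk_right t))).aestronglyMeasurable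
      · filter_upwards [hfin] with z hz
        rw [← toReal_enorm]
        refine ENNReal.toReal_mono hz.ne ?_
        rw [enorm_mul]
        gcongr
        exact hSb n _
      · filter_upwards [h2] with z hz
        exact hz.const_mul _
    have hconv' : Filter.Tendsto (fun n => ∫ z, ψ z * freeWave (truncate f (r n)) (t, z))
        Filter.atTop (nhds (zkFlow t u₀ ψ)) := by
      obtain ⟨Ψ, hΨ⟩ : ∃ Ψ : 𝓢(Space3, ℂ), Ψ = 𝓕⁻ ψ := ⟨_, rfl⟩
      simp only [integral_schwartz_mul_freeWave t (integrable_truncate hf _) ψ,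
        zkFlow_apply_eq t hu₀ ψ, ← hΨ]
      have hsm : Continuous (zkSymbol t) := (hasTemperateGrowth_zkSymbol t).1.continuous
      refine tendsto_integral_of_dominated_convergence (fun ζ => ‖Ψ ζ * f ζ‖)
        (fun n => ?_) (hχ _).norm (fun n => .of_forall fun ζ => ?_) (.of_forall fun ζ => ?_)
      · exact (hsm.mul Ψ.continuous).aestronglyMeasurable.mul
          (integrable_truncate hf _).1
      · rw [norm_mul, norm_mul, norm_mul, zkSymbol_eq, Circle.norm_coe, one_mul]
        gcongr
        exact norm_indicator_le_norm_self _ _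
      · exact (tendsto_truncate f hr ζ).const_mul _
    exact tendsto_nhds_unique hconv' hconv

/-! ### Free solutions with weighted `L²` data -/

/-- `u` is a limit of free solutions with truncated Fourier data `f`. -/
def IsTruncationLimit (u : ℝ × Space3 → ℂ) (f : Space3 → ℂ) : Prop :=
  ∃ r : ℕ → ℕ, ∀ᵐ p, Filter.Tendsto (fun n => freeWave (truncate f (r n)) p) Filter.atTop
    (nhds (u p))

lemma exists_isFreeSolution_isTruncationLimit {α : ℝ → ℝ≥0∞} (hα : Measurable α)
    (hαc : LocallyControls α) {f : Space3 → ℂ} (hf : LocallyIntegrable f)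
    (hfα : weightedSq α f ≠ ∞) {u₀ : 𝓢'(Space3, ℂ)}
    (hχ : ∀ χ : 𝓢(Space3, ℂ), Integrable fun ζ => χ ζ * f ζ)
    (hu₀ : ∀ χ : 𝓢(Space3, ℂ), (𝓕 u₀) χ = ∫ ζ, χ ζ * f ζ) :
    ∃ u, IsFreeSolution u u₀ ∧ IsTruncationLimit u f := by
  obtain ⟨r, u, S, hr, hu, hS, hSK, hSb, hlim⟩ := exists_tendsto_freeWave_truncate hα hαc hf hfα
  exact ⟨u, isFreeSolution_of_tendsto hf hr hu hS hSK hSb hlim hχ hu₀, r, hlim⟩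

/-- Fatou's lemma, since truncation never increases a weighted norm. The two subsequences need not
agree. -/
lemma IsTruncationLimit.lintegral_mul_sq_le {α β : ℝ → ℝ≥0∞} {A : ℝ≥0∞}
    (h : AdmissibleWeights α β A) {u v : ℝ × Space3 → ℂ} {f g : Space3 → ℂ}
    (hf : LocallyIntegrable f) (hg : LocallyIntegrable g)
    (hu : IsTruncationLimit u f) (hv : IsTruncationLimit v g) :
    ∫⁻ p, ‖u p * v p‖ₑ ^ 2 ≤ 16 * A * (weightedSq α f * weightedSq β g) := by
  obtain ⟨r, hr⟩ := hu
  obtain ⟨r', hr'⟩ := hv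
  have hm : ∀ n, Measurable fun p =>
      ‖freeWave (truncate f (r n)) p * freeWave (truncate g (r' n)) p‖ₑ ^ 2 := fun n =>
    ((continuous_freeWave (integrable_truncate hf _)).mul
      (continuous_freeWave (integrable_truncate hg _))).measurable.enorm.pow_const 2
  calc ∫⁻ p, ‖u p * v p‖ₑ ^ 2 = ∫⁻ p, Filter.liminf (fun n =>
        ‖freeWave (truncate f (r n)) p * freeWave (truncate g (r' n)) p‖ₑ ^ 2) Filter.atTop := by
        refine lintegral_congr_ae ?_
        filter_upwards [hr, hr'] with p h1 h2
        exact (((ENNReal.continuous_pow 2).tendsto _).comp (h1.mul h2).enorm).liminf_eq.symm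
    _ ≤ Filter.liminf (fun n => ∫⁻ p,
        ‖freeWave (truncate f (r n)) p * freeWave (truncate g (r' n)) p‖ₑ ^ 2) Filter.atTop :=
        lintegral_liminf_le hm
    _ ≤ Filter.liminf (fun _ : ℕ => 16 * A * (weightedSq α f * weightedSq β g)) Filter.atTop := by
        refine Filter.liminf_le_liminf (.of_forall fun n => ?_)
        refine (lintegral_freeWave_mul_sq_le h (integrable_truncate hf _)
          (integrable_truncate hg _)).trans ?_
        gcongr
        · exact weightedSq_mono α fun ζ => enorm_indicator_le _ _
        · exact weightedSq_mono β fun ζ => enorm_indicator_le _ _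
    _ = _ := Filter.liminf_const _

/-! ### The weights -/

lemma admissibleWeights_one : AdmissibleWeights (fun _ => 1) (fun _ => 1) 1 where
  measurable_left := measurable_const
  measurable_right := measurable_const
  even_left _ := rfl
  even_right _ := rfl
  left_ne_zero _ _ := one_ne_zero
  left_ne_top _ _ := ENNReal.one_ne_top
  right_ne_zero _ _ := one_ne_zero
  right_ne_top _ _ := ENNReal.one_ne_top
  -- The kernel is `ξ / (4πξ) = 1 / (4π)`.
  kernel_le ξ hξ := by
    have hπ := Real.pi_gt_three
    simp only [inv_one, one_pow, mul_one, lintegral_const, Measure.restrict_apply MeasurableSet.univ,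
      Set.univ_inter, Real.volume_Ioo, sub_zero, one_mul]
    rw [← ENNReal.ofReal_mul (by positivity), ← ENNReal.ofReal_one]
    refine ENNReal.ofReal_le_ofReal ?_
    rw [one_div, inv_mul_le_iff₀ (by positivity)]
    nlinarith

/-- The weight `|ξ| ^ (-1/2)`. -/
noncomputable def negHalfWeight (x : ℝ) : ℝ≥0∞ :=
  ENNReal.ofReal (|2 * Real.pi * x| ^ (-1 / 2 : ℝ))

/-- The weight `⟨ξ⟩ ^ s`. -/
noncomputable def bracketWeight (s x : ℝ) : ℝ≥0∞ :=
  ENNReal.ofReal ((1 + (2 * Real.pi * x) ^ 2) ^ (s / 2))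

lemma inv_sq_bracketWeight (s x : ℝ) :
    (bracketWeight s x)⁻¹ ^ 2 = ENNReal.ofReal ((1 + (2 * Real.pi * x) ^ 2) ^ (-s)) := by
  have h : 0 < 1 + (2 * Real.pi * x) ^ 2 := by positivity
  rw [bracketWeight, ← ENNReal.ofReal_inv_of_pos (by positivity),
    ← ENNReal.ofReal_pow (by positivity), ← Real.rpow_neg h.le, ← Real.rpow_natCast,
    ← Real.rpow_mul h.le]
  congr 2
  push_cast
  ring

lemma inv_sq_negHalfWeight {x : ℝ} (hx : 0 < x) :
    (negHalfWeight x)⁻¹ ^ 2 = ENNReal.ofReal (2 * Real.pi * x) := by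
  have h : 0 < 2 * Real.pi * x := by positivity
  rw [negHalfWeight, abs_of_pos h, ← ENNReal.ofReal_inv_of_pos (by positivity),
    ← ENNReal.ofReal_pow (by positivity), ← Real.rpow_neg h.le, ← Real.rpow_natCast,
    ← Real.rpow_mul h.le]
  norm_num

/-- The integrand is `⟨2πx⟩^(-2s)`, integrable on the line because `2s > 1`. -/
lemma lintegral_inv_sq_bracketWeight_ne_top {s : ℝ} (hs : 1 / 2 < s) :
    ∫⁻ x, (bracketWeight s x)⁻¹ ^ 2 ≠ ∞ := by
  simp only [inv_sq_bracketWeight]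
  have h1 : Integrable (fun x : ℝ => (1 + ‖x‖ ^ 2) ^ (-(2 * s) / 2)) :=
    integrable_rpow_neg_one_add_norm_sq (by simp; linarith)
  have h2 := h1.comp_mul_left' (R := 2 * Real.pi) (by positivity)
  have h3 : (fun x : ℝ => (1 + (2 * Real.pi * x) ^ 2) ^ (-s)) =
      fun x => (1 + ‖2 * Real.pi * x‖ ^ 2) ^ (-(2 * s) / 2) := by
    funext x
    rw [Real.norm_eq_abs, sq_abs]
    congr 1
    ring
  exact (h3 ▸ h2).lintegral_lt_top.ne

/-- On `(0, ξ)` one has `α⁻² = 2πx ≤ 2πξ`, which cancels `1/(4πξ)` up to a factor `1/2`. At `x = 0`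
the real power makes `negHalfWeight` equal to `0`, which the restriction to positive `x` excludes.
-/
lemma admissibleWeights_negHalf_bracket (s : ℝ) :
    AdmissibleWeights negHalfWeight (bracketWeight s) (∫⁻ x, (bracketWeight s x)⁻¹ ^ 2) where
  measurable_left := by unfold negHalfWeight; fun_prop
  measurable_right := by unfold bracketWeight; fun_prop
  even_left x := by simp [negHalfWeight]
  even_right x := by simp [bracketWeight]
  left_ne_zero x hx := by
    have : 0 < |2 * Real.pi * x| := abs_pos.2 (by positivity)
    simp only [negHalfWeight, ne_eq, ENNReal.ofReal_eq_zero, not_le]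
    positivity
  left_ne_top _ _ := ENNReal.ofReal_ne_top
  right_ne_zero x _ := by
    simp only [bracketWeight, ne_eq, ENNReal.ofReal_eq_zero, not_le]
    positivity
  right_ne_top _ _ := ENNReal.ofReal_ne_top
  kernel_le ξ hξ := by
    have hβ : Measurable fun x => (bracketWeight s x)⁻¹ ^ 2 := by unfold bracketWeight; fun_prop
    calc ENNReal.ofReal (1 / (4 * Real.pi * ξ)) *
          (∫⁻ x in Set.Ioo 0 ξ, (negHalfWeight x)⁻¹ ^ 2 * (bracketWeight s (ξ - x))⁻¹ ^ 2)
        ≤ ENNReal.ofReal (1 / (4 * Real.pi * ξ)) *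
          (∫⁻ x in Set.Ioo 0 ξ, ENNReal.ofReal (2 * Real.pi * ξ) *
            (bracketWeight s (ξ - x))⁻¹ ^ 2) := by
          refine mul_le_mul' le_rfl (setLIntegral_mono' measurableSet_Ioo fun x hx => ?_)
          rw [inv_sq_negHalfWeight hx.1]
          gcongr
          exact hx.2.le
      _ ≤ ENNReal.ofReal (1 / (4 * Real.pi * ξ)) * (ENNReal.ofReal (2 * Real.pi * ξ) *
            ∫⁻ x, (bracketWeight s (ξ - x))⁻¹ ^ 2) := by
          exact mul_le_mul' le_rfl ((setLIntegral_le_lintegral _ _).trans_eq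
            (lintegral_const_mul' _ _ ENNReal.ofReal_ne_top))
      _ ≤ ∫⁻ x, (bracketWeight s x)⁻¹ ^ 2 := by
          rw [lintegral_sub_left_eq_self (fun x => (bracketWeight s x)⁻¹ ^ 2) ξ, ← mul_assoc,
            ← ENNReal.ofReal_mul (by positivity)]
          refine mul_le_of_le_one_left' ?_
          rw [← ENNReal.ofReal_one]
          refine ENNReal.ofReal_le_ofReal ?_
          rw [one_div, inv_mul_le_iff₀ (by positivity)]
          nlinarith [Real.pi_pos]

lemma weightedSq_indicator_ball_ne_top {β : ℝ → ℝ≥0∞} {M : ℝ≥0∞} (hM : M ≠ ∞)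
    (hβ : ∀ x, |x| ≤ 1 → β x ≤ M) :
    weightedSq β ((Metric.ball 0 1).indicator fun _ => 1) ≠ ∞ := by
  have h : ∀ ζ : Space3, (β (ζ 0) * ‖(Metric.ball (0 : Space3) 1).indicator
      (fun _ => (1 : ℂ)) ζ‖ₑ) ^ 2 ≤ (Metric.ball (0 : Space3) 1).indicator (fun _ => M ^ 2) ζ := by
    intro ζ
    by_cases hζ : ζ ∈ Metric.ball (0 : Space3) 1
    · have h1 : |ζ 0| ≤ 1 := (PiLp.norm_apply_le ζ 0).trans (mem_ball_zero_iff.1 hζ).le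
      simp only [Set.indicator_of_mem hζ, enorm_one, mul_one]
      exact pow_le_pow_left' (hβ _ h1) 2
    · simp [hζ]
  refine ne_top_of_le_ne_top ?_ (lintegral_mono h)
  rw [lintegral_indicator Metric.isOpen_ball.measurableSet, lintegral_const,
    Measure.restrict_apply MeasurableSet.univ, Set.univ_inter]
  exact ENNReal.mul_ne_top (ENNReal.pow_ne_top hM) measure_ball_lt_top.ne

lemma locallyControls_one : LocallyControls fun _ => 1 :=
  locallyControls_of_admissibleWeights ENNReal.one_ne_top admissibleWeights_one
    (weightedSq_indicator_ball_ne_top ENNReal.one_ne_top fun _ _ => le_rfl)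

lemma locallyControls_negHalfWeight : LocallyControls negHalfWeight := by
  -- The partner weight is auxiliary: any exponent above `1/2` serves, and `s = 1` is taken.
  refine locallyControls_of_admissibleWeights
    (lintegral_inv_sq_bracketWeight_ne_top (s := 1) (by norm_num))
    (admissibleWeights_negHalf_bracket 1)
    (weightedSq_indicator_ball_ne_top
      (M := ENNReal.ofReal ((1 + (2 * Real.pi * 1) ^ 2) ^ ((1 : ℝ) / 2)))
      ENNReal.ofReal_ne_top fun x hx => ?_)
  rw [bracketWeight]
  refine ENNReal.ofReal_le_ofReal (Real.rpow_le_rpow (by positivity) ?_ (by norm_num))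
  have : x ^ 2 ≤ 1 := (sq_le_one_iff_abs_le_one x).2 hx
  rw [mul_pow, mul_pow _ (1 : ℝ), one_pow]
  gcongr

/-! ### The three classes of initial data -/

lemma lintegral_enorm_fourier_sq_eq (g : Lp ℂ 2 (volume : Measure Space3)) :
    ∫⁻ ζ, ‖(𝓕 g : Lp ℂ 2 (volume : Measure Space3)) ζ‖ₑ ^ 2 = ‖g‖ₑ ^ 2 := by
  rw [lintegral_enorm_sq_eq_eLpNorm_sq, ← Lp.enorm_def]
  congr 1
  rw [enorm_eq_iff_norm_eq, Lp.norm_fourier_eq]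

lemma integrable_schwartz_mul_Lp (χ : 𝓢(Space3, ℂ)) (g : Lp ℂ 2 (volume : Measure Space3)) :
    Integrable fun ζ => χ ζ * g ζ :=
  MemLp.integrable_mul (χ.memLp 2) (Lp.memLp g)

lemma exists_isFreeSolution_of_Lp (u₀ : Lp ℂ 2 (volume : Measure Space3)) :
    ∃ (f : Space3 → ℂ) (u : ℝ × Space3 → ℂ), LocallyIntegrable f ∧
      weightedSq (fun _ => 1) f = ‖u₀‖ₑ ^ 2 ∧ IsFreeSolution u (u₀ : 𝓢'(Space3, ℂ)) ∧
      IsTruncationLimit u f := by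
  have hf : LocallyIntegrable (𝓕 u₀ : Lp ℂ 2 (volume : Measure Space3)) volume :=
    (Lp.memLp _).locallyIntegrable one_le_two
  have hw : weightedSq (fun _ => 1) (𝓕 u₀ : Lp ℂ 2 (volume : Measure Space3)) = ‖u₀‖ₑ ^ 2 := by
    simp only [weightedSq, one_mul]
    exact lintegral_enorm_fourier_sq_eq u₀
  obtain ⟨u, hu, hul⟩ := exists_isFreeSolution_isTruncationLimit (u₀ := (u₀ : 𝓢'(Space3, ℂ)))
    measurable_const locallyControls_one hf (by rw [hw]; simp)
    (fun χ => integrable_schwartz_mul_Lp χ _) (fun χ => by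
      rw [Lp.fourier_toTemperedDistribution_eq, Lp.toTemperedDistribution_apply]
      simp only [smul_eq_mul])
  exact ⟨_, u, hf, hw, hu, hul⟩

lemma norm_bracketSymbol (s : ℝ) (ζ : Space3) :
    ‖bracketSymbol s ζ‖ = (1 + (2 * Real.pi * ζ 0) ^ 2) ^ (s / 2) := by
  rw [bracketSymbol, Complex.norm_real, Real.norm_of_nonneg (by positivity)]

lemma eq_bracketDx_neg {s : ℝ} {v₀ w : 𝓢'(Space3, ℂ)} (h : bracketDx s v₀ = w) :
    v₀ = bracketDx (-s) w := by
  have h1 : bracketSymbol s * bracketSymbol (-s) = fun _ => 1 := by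
    funext ζ
    have : 0 < 1 + (2 * Real.pi * ζ 0) ^ 2 := by positivity
    simp only [Pi.mul_apply, bracketSymbol]
    rw [← Complex.ofReal_mul, ← Real.rpow_add this, ← add_div, add_neg_cancel, zero_div,
      Real.rpow_zero, Complex.ofReal_one]
  rw [← h, bracketDx, bracketDx,
    TemperedDistribution.fourierMultiplierCLM_fourierMultiplierCLM_apply
      (hasTemperateGrowth_bracketSymbol s) (hasTemperateGrowth_bracketSymbol (-s)), h1,
    TemperedDistribution.fourierMultiplierCLM_const]
  simp

lemma exists_isFreeSolution_of_bracketDx {s : ℝ} (hs : 0 ≤ s) {v₀ : 𝓢'(Space3, ℂ)}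
    {h : Lp ℂ 2 (volume : Measure Space3)} (hv : bracketDx s v₀ = (h : 𝓢'(Space3, ℂ))) :
    ∃ (f : Space3 → ℂ) (v : ℝ × Space3 → ℂ), LocallyIntegrable f ∧
      weightedSq (bracketWeight s) f = ‖h‖ₑ ^ 2 ∧ IsFreeSolution v v₀ ∧
      IsTruncationLimit v f := by
  set H : Space3 → ℂ := ⇑(𝓕 h : Lp ℂ 2 (volume : Measure Space3))
  set f : Space3 → ℂ := fun ζ => bracketSymbol (-s) ζ * H ζ
  have hb := hasTemperateGrowth_bracketSymbol (-s)
  have hHl : LocallyIntegrable H := (Lp.memLp _).locallyIntegrable one_le_two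
  have hf : LocallyIntegrable f := by
    rw [locallyIntegrable_iff]
    intro K hK
    exact (hHl.integrableOn_isCompact hK).continuousOn_mul hb.1.continuous.continuousOn hK
  have hw : weightedSq (bracketWeight s) f = ‖h‖ₑ ^ 2 := by
    rw [← lintegral_enorm_fourier_sq_eq h]
    refine lintegral_congr fun ζ => ?_
    have hp : 0 < 1 + (2 * Real.pi * ζ 0) ^ 2 := by positivity
    simp only [f, H]
    rw [enorm_mul, ← ofReal_norm (bracketSymbol (-s) ζ), norm_bracketSymbol, bracketWeight,
      ← mul_assoc, ← ENNReal.ofReal_mul (by positivity), ← Real.rpow_add hp, ← add_div,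
      add_neg_cancel, zero_div, Real.rpow_zero, ENNReal.ofReal_one, one_mul]
  -- For `s ≥ 0` the bracket weight is at least `1`, so the datum lies in `L²` and the unweighted
  -- construction applies.
  have hw1 : weightedSq (fun _ => 1) f ≠ ∞ := by
    refine ne_top_of_le_ne_top (b := ‖h‖ₑ ^ 2) (by simp) ?_
    rw [← hw]
    refine lintegral_mono fun ζ => ?_
    gcongr
    rw [bracketWeight, ← ENNReal.ofReal_one]
    exact ENNReal.ofReal_le_ofReal
      (Real.one_le_rpow (le_add_of_nonneg_right (sq_nonneg _)) (by positivity))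
  have hχe : ∀ χ : 𝓢(Space3, ℂ), (fun ζ => χ ζ * f ζ) =
      fun ζ => SchwartzMap.smulLeftCLM ℂ (bracketSymbol (-s)) χ ζ * H ζ := by
    intro χ
    funext ζ
    simp only [SchwartzMap.smulLeftCLM_apply_apply hb, smul_eq_mul, f]
    ring
  obtain ⟨v, hv, hvl⟩ := exists_isFreeSolution_isTruncationLimit (u₀ := v₀)
    measurable_const locallyControls_one hf hw1
    (fun χ => by
      rw [hχe]
      exact integrable_schwartz_mul_Lp _ _)
    (fun χ => by
      rw [hχe, eq_bracketDx_neg hv, bracketDx, TemperedDistribution.fourierMultiplierCLM_apply,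
        FourierTransform.fourier_fourierInv_eq, TemperedDistribution.smulLeftCLM_apply_apply,
        Lp.fourier_toTemperedDistribution_eq, Lp.toTemperedDistribution_apply]
      simp only [smul_eq_mul, H])
  exact ⟨f, v, hf, hw, hv, hvl⟩

/-- Here `f = |2πξ|^(1/2) ĝ` need not be in `L²`, hence the local bounds for `negHalfWeight` and the
extension of the representation by `IsGivenBy.apply_eq`. -/
lemma exists_isFreeSolution_of_isDxPow {u₀ : 𝓢'(Space3, ℂ)}
    {g : Lp ℂ 2 (volume : Measure Space3)} (hu : IsDxPow (-1 / 2) u₀ g) :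
    ∃ (f : Space3 → ℂ) (u : ℝ × Space3 → ℂ), LocallyIntegrable f ∧
      weightedSq negHalfWeight f = ‖g‖ₑ ^ 2 ∧ IsFreeSolution u u₀ ∧ IsTruncationLimit u f := by
  obtain ⟨f, hf, hfg⟩ := hu
  have hw : weightedSq negHalfWeight f = ‖g‖ₑ ^ 2 := by
    rw [← lintegral_enorm_fourier_sq_eq g]
    refine lintegral_congr_ae ?_
    filter_upwards [hfg] with ζ hζ
    rw [hζ, enorm_mul, negHalfWeight, ← ofReal_norm (((_ : ℝ) : ℂ)), Complex.norm_real,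
      Real.norm_of_nonneg (by positivity)]
  have hχ : ∀ χ : 𝓢(Space3, ℂ), Integrable fun ζ => χ ζ * f ζ := by
    intro χ
    refine (integrable_schwartz_mul_Lp (SchwartzMap.smulLeftCLM ℂ (bracketSymbol 1) χ)
      (𝓕 g)).mono (χ.continuous.aestronglyMeasurable.mul hf.1.aestronglyMeasurable) ?_
    have h0 : ∀ᵐ ζ : Space3, ζ 0 ≠ 0 := by
      rw [ae_iff]; simpa using volume_setOf_coord_eq_zero
    filter_upwards [hfg, h0] with ζ hζ hζ0
    set a : ℝ := |2 * Real.pi * ζ 0| with ha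
    have ha0 : 0 < a := abs_pos.2 (mul_ne_zero (by positivity) hζ0)
    rw [SchwartzMap.smulLeftCLM_apply_apply (hasTemperateGrowth_bracketSymbol 1), hζ, norm_mul,
      norm_mul, norm_smul, norm_mul, norm_bracketSymbol, Complex.norm_real,
      Real.norm_of_nonneg (by positivity), ← sq_abs, ← ha]
    -- Since `a ≤ 1 + a²`, the growth `a^(1/2)` is absorbed by the symbol of order one applied to
    -- `χ`.
    have h1 : 1 ≤ (1 + a ^ 2) ^ ((1 : ℝ) / 2) * a ^ (-1 / 2 : ℝ) := by
      calc (1 : ℝ) = a ^ ((1 : ℝ) / 2) * a ^ (-1 / 2 : ℝ) := by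
            rw [← Real.rpow_add ha0]; norm_num
        _ ≤ _ := by
          gcongr
          nlinarith [sq_nonneg (a - 1)]
    calc ‖χ ζ‖ * ‖f ζ‖ ≤ ((1 + a ^ 2) ^ ((1 : ℝ) / 2) * a ^ (-1 / 2 : ℝ)) *
          (‖χ ζ‖ * ‖f ζ‖) := le_mul_of_one_le_left (by positivity) h1
      _ = _ := by ring
  obtain ⟨u, hu, hul⟩ := exists_isFreeSolution_isTruncationLimit (u₀ := u₀)
    (admissibleWeights_negHalf_bracket 1).measurable_left locallyControls_negHalfWeight hf.1
    (by rw [hw]; simp) hχ (fun χ => hf.apply_eq χ (hχ χ))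
  exact ⟨f, u, hf.1, hw, hu, hul⟩

/-! ### The two estimates. -/

theorem mainTheorem4 :
    (∀ s : ℝ, 1 / 2 < s → ∃ C : ℝ≥0,
      ∀ (u₀ v₀ : 𝓢'(Space3, ℂ)) (g h : Lp ℂ 2 (volume : Measure Space3)),
        IsDxPow (-1 / 2) u₀ g →
        bracketDx s v₀ = (h : 𝓢'(Space3, ℂ)) →
        (∃ u : ℝ × Space3 → ℂ, IsFreeSolution u u₀) ∧
        (∃ v : ℝ × Space3 → ℂ, IsFreeSolution v v₀) ∧
        ∀ u v : ℝ × Space3 → ℂ, IsFreeSolution u u₀ → IsFreeSolution v v₀ →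
          eLpNorm (fun p => u p * v p) 2 volume ≤ C * ‖g‖ₑ * ‖h‖ₑ) ∧
    (∃ C : ℝ≥0, ∀ u₀ : Lp ℂ 2 (volume : Measure Space3),
      (∃ u : ℝ × Space3 → ℂ, IsFreeSolution u (u₀ : 𝓢'(Space3, ℂ))) ∧
      ∀ u : ℝ × Space3 → ℂ, IsFreeSolution u (u₀ : 𝓢'(Space3, ℂ)) →
        eLpNorm u 4 volume ≤ C * ‖u₀‖ₑ) := by
  -- The Strichartz constant is `2 = 16^(1/4)`, from `16 A` with `A = 1`.
  refine ⟨fun s hs => ?_, 2, fun u₀ => ?_⟩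
  · have hA := lintegral_inv_sq_bracketWeight_ne_top hs
    have hadm := admissibleWeights_negHalf_bracket s
    set A := ∫⁻ x, (bracketWeight s x)⁻¹ ^ 2
    have hA16 : 16 * A ≠ ∞ := ENNReal.mul_ne_top (by norm_num) hA
    -- Only `C² ≥ 16 A` is needed, and `(16 A + 1)²` suffices.
    refine ⟨(16 * A).toNNReal + 1, fun u₀ v₀ g h hu₀ hv₀ => ?_⟩
    obtain ⟨f, u, hf, hfg, hu, hul⟩ := exists_isFreeSolution_of_isDxPow hu₀
    obtain ⟨f', v, hf', hfh, hv, hvl⟩ :=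
      exists_isFreeSolution_of_bracketDx (by linarith : 0 ≤ s) hv₀
    refine ⟨⟨u, hu⟩, ⟨v, hv⟩, fun u' v' hu' hv' => ?_⟩
    have hae : (fun p => u' p * v' p) =ᵐ[volume] fun p => u p * v p :=
      (hu'.ae_eq hu).mul (hv'.ae_eq hv)
    rw [eLpNorm_congr_ae hae]
    refine (ENNReal.pow_right_strictMono two_ne_zero).le_iff_le.1 ?_
    rw [← lintegral_enorm_sq_eq_eLpNorm_sq]
    refine (hul.lintegral_mul_sq_le hadm hf hf' hvl).trans ?_
    rw [hfg, hfh, mul_assoc _ ‖g‖ₑ, mul_pow, mul_pow]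
    refine mul_le_mul' ?_ le_rfl
    rw [ENNReal.coe_add, ENNReal.coe_toNNReal hA16, ENNReal.coe_one]
    calc 16 * A ≤ (16 * A + 1) * 1 := by rw [mul_one]; exact le_self_add
      _ ≤ (16 * A + 1) * (16 * A + 1) := by gcongr; exact le_add_self
      _ = _ := (sq _).symm
  · obtain ⟨f, u, hf, hfu, hu, hul⟩ := exists_isFreeSolution_of_Lp u₀
    refine ⟨⟨u, hu⟩, fun u' hu' => ?_⟩
    rw [eLpNorm_congr_ae (hu'.ae_eq hu)]
    have h1 := hul.lintegral_mul_sq_le admissibleWeights_one hf hf hul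
    have h2 := eLpNorm_nnreal_pow_eq_lintegral (f := u) (μ := volume) (p := 4) (by norm_num)
    norm_num at h2
    have h3 : eLpNorm u 4 volume ^ 4 = ∫⁻ p, ‖u p‖ₑ ^ 4 := by exact_mod_cast h2
    refine (ENNReal.pow_right_strictMono four_ne_zero).le_iff_le.1 ?_
    rw [h3]
    calc ∫⁻ p, ‖u p‖ₑ ^ 4 = ∫⁻ p, ‖u p * u p‖ₑ ^ 2 := by
          refine lintegral_congr fun p => ?_
          rw [enorm_mul]
          ring
      _ ≤ _ := h1
      _ = _ := by
          rw [hfu]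
          push_cast
          ring
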